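/- **Setting.** An ultragraph $\mathcal U=(U^0,\mathcal U^1,r,s)$ consists of a vertex set $U^0$, an edge set $\mathcal U^1$ and maps $r,s:\mathcal U^1\to P(U^0)\setminus\{\varnothing\}$ such that every $r(e)$ is a singleton. Assume $\{e: r(e)=\{v\}\}$ is finite and nonempty for every $v\in U^0$. Let $\mathcal U^0\subseteq P(U^0)$ be the smallest family that contains $\varnothing$, all $\{v\}$ and all $s(e)$ and is closed under finite $\cap$, $\cup$ and $\setminus$. Let $\mathcal U^{\ge 1}$ be the set of paths $e_1\cdots e_n$ ($n\ge 1$, $r(e_{i+1})\subseteq s(e_i)$), with $r(e_1\cdots e_n)=r(e_1)$ and $s(e_1\cdots e_n)=s(e_n)$, and let $\mathcal U^\sharp=\mathcal U^{\ge1}\cup\{\omega\}$, where $\omega$ is the empty path, $r(\omega)=s(\omega)=U^0$. Let $(G,\mathcal U,\varphi)$ be a self-similar ultragraph: a (discrete) group $G$ acts on $U^0$ and on $\mathcal U^1$ with $r(g\cdot e)=g\cdot r(e)$, $s(g\cdot e)=g\cdot s(e)$, and $\varphi:G\times\mathcal U^1\to G$ satisfies $\varphi(gh,e)=\varphi(g,h\cdot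 e)\varphi(h,e)$ and $\varphi(g,e)\cdot s(e)\subseteq g\cdot s(e)$. Extend to paths by $g\cdot\omega=\omega$, $\varphi(g,\omega)=g$, $g\cdot(e\alpha)=(g\cdot e)(\varphi(g,e)\cdot\alpha)$ and $\varphi(g,e\alpha)=\varphi(\varphi(g,e),\alpha)$. Let $\mathcal S_{G,\mathcal U}$ be the inverse semigroup with zero consisting of $0$ and all $(\alpha,A,g,\beta)$ with $\alpha,\beta\in\mathcal U^\sharp$, $g\in G$, $A\in\mathcal U^0$ and $\varnothing\ne A\subseteq s(\alpha)\cap g\cdot s(\beta)$, with $(\alpha,A,g,\beta)^*=(\beta,g^{-1}\cdot A,g^{-1},\alpha)$ and with $(\alpha,A,g,\beta)(\gamma,B,h,\delta)$ equal to - $\big(\alpha(g\cdot\varepsilon),\ s(g\cdot\varepsilon)\cap\varphi(g,\varepsilon)\cdot B,\ \varphi(g,\varepsilon)h,\ \delta\big)$ if $\gamma=\beta\varepsilon$ with $\varepsilon\in\mathcal U^{\ge1}$ and $g\cdot r(\varepsilon)\subseteq A$; - $\big(\alpha,\ A\cap g\varphi(h^{-1},\varepsilon)^{-1}\cdot s(h^{-1}\cdot\varepsilon),\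 g\varphi(h^{-1},\varepsilon)^{-1},\ \delta(h^{-1}\cdot\varepsilon)\big)$ if $\beta=\gamma\varepsilon$ with $\varepsilon\in\mathcal U^{\ge1}$ and $r(\varepsilon)\subseteq B$; - $(\alpha,\ A\cap g\cdot B,\ gh,\ \delta)$ if $\gamma=\beta$ and $A\cap g\cdot B\neq\varnothing$; - $0$ otherwise. For an inverse semigroup $S$ with zero, a filter is a nonempty set of idempotents that is closed under products and upward closed in the natural order ($s\le t$ if $s=te$ for some idempotent $e$). The filters not containing $0$ carry the topology generated by the sets $\{\mathcal F: e\in\mathcal F,\ e_1,\dots,e_n\notin\mathcal F\}$ with $e,e_1,\dots,e_n$ idempotent. The tight spectrum $\mathcal T$ of $S$ is the closure of the set of ultrafilters (maximal filters not containing $0$), with the subspace topology. For $\mathcal F\in\mathcal T$ with $s^*s\in\mathcal F$ let $\theta_s(\mathcal F)$ be the set of all idempotents that lie above some $ses^*$ with $e\in\mathcal F$. The tight groupoid $\mathcal G_{\mathrm{tight}}(S)$ is the set of classes $[s,\mathcal F]$ of pairs with $s\in S$ and $s^*s\in\mathcal F\in\mathcal T$, where $(s,\mathcal F)\sim(t,\mathcal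 F')$ if $\mathcal F=\mathcal F'$ and $se=te$ for some $e\in\mathcal F$. Its operations are $[t,\theta_s(\mathcal F)][s,\mathcal F]=[ts,\mathcal F]$ and $[s,\mathcal F]^{-1}=[s^*,\theta_s(\mathcal F)]$, and its topology is generated by the sets $[s,V]=\{[s,\mathcal F]:\mathcal F\in V,\ s^*s\in\mathcal F\}$ with $s\in S$ and $V\subseteq\mathcal T$ open. For a groupoid $\mathcal G$ with a topology, with $r(x)=xx^{-1}$, $s(x)=x^{-1}x$ and unit space $\mathcal G^{(0)}=\{x^{-1}x:x\in\mathcal G\}$, a bisection is a set $B\subseteq\mathcal G$ on which both $r$ and $s$ restrict to homeomorphisms onto their images. $\mathcal G$ is ample if multiplication, inversion, $r$ and $s$ are continuous, $\mathcal G$ is locally compact, $r,s:\mathcal G\to\mathcal G^{(0)}$ are local homeomorphisms, and the topology has a basis of compact open bisections. **Proposition.** $\mathcal G_{\mathrm{tight}}(\mathcal S_{G,\mathcal U})$ is an ample groupoid with Hausdorff unit space. Moreover, the sets $$\Theta(\alpha,A,g,\beta)=[(\alpha,A,g,\beta),\,Z(\beta,g^{-1}\cdot A)],\qquad Z(\beta,C)=\{\mathcal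 F\in\mathcal T:(\beta,C,1_G,\beta)\in\mathcal F\},$$ for $\alpha,\beta\in\mathcal U^\sharp$, $g\in G$ and $A\in\mathcal U^0$ with $\varnothing\neq A\subseteq s(\alpha)\cap g\cdot s(\beta)$, are compact open bisections and form a basis of the topology of $\mathcal G_{\mathrm{tight}}(\mathcal S_{G,\mathcal U})$. -/

import Mathlib

/-- An inverse semigroup with zero: every `s` has a unique generalized inverse, denoted `star s`. -/
class InverseSemigroupWithZero (S : Type*) extends SemigroupWithZero S, Star S where
  mul_star_mul : ∀ s : S, s * star s * s = s
  star_mul_star_self : ∀ s : S, star s * s * star s = star s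
  eq_star : ∀ s t : S, s * t * s = s → t * s * t = t → t = star s

namespace InverseSemigroupWithZero

variable {S : Type*} [InverseSemigroupWithZero S]

theorem star_star' (s : S) : star (star s) = s :=
  (eq_star (star s) s (star_mul_star_self s) (mul_star_mul s)).symm

theorem star_of_idem {e : S} (he : e * e = e) : star e = e :=
  (eq_star e e (by rw [he, he]) (by rw [he, he])).symm

theorem idem_mul {e f : S} (he : e * e = e) (hf : f * f = f) : (e * f) * (e * f) = e * f := by
  have a1 : ∀ z : S, e * (e * z) = e * z := fun z => by rw [← mul_assoc, he]
  have a2 : ∀ z : S, f * (f * z) = f * z := fun z => by rw [← mul_assoc, hf]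
  have h1 := mul_star_mul (e * f)
  have h2 := star_mul_star_self (e * f)
  simp only [mul_assoc] at h1 h2
  have h3 : f * star (e * f) * e = star (e * f) := by
    refine eq_star _ _ ?_ ?_
    · simp only [mul_assoc, a1, a2, h1]
    · simp only [mul_assoc, a1, a2]
      congr 1
      have := congrArg (· * e) h2
      simpa only [mul_assoc] using this
  have h4 : star (e * f) * star (e * f) = star (e * f) := by
    conv_lhs => rw [← h3]
    have h5 : f * star (e * f) * e * (f * star (e * f) * e) = f * star (e * f) * e := by
      simp only [mul_assoc]
      congr 1
      have := congrArg (· * e) h2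
      simpa only [mul_assoc] using this
    rw [h5, h3]
  have h5 := star_of_idem h4
  rw [star_star'] at h5
  rw [h5, h4]

theorem idem_comm {e f : S} (he : e * e = e) (hf : f * f = f) : e * f = f * e := by
  have h1 := idem_mul he hf
  have h2 := idem_mul hf he
  have a1 : ∀ z : S, e * (e * z) = e * z := fun z => by rw [← mul_assoc, he]
  have a2 : ∀ z : S, f * (f * z) = f * z := fun z => by rw [← mul_assoc, hf]
  have h3 : f * e = star (e * f) := by
    refine eq_star _ _ ?_ ?_
    · simp only [mul_assoc, a1, a2] at h1 ⊢
      exact h1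
    · simp only [mul_assoc, a1, a2] at h2 ⊢
      exact h2
  rw [h3, star_of_idem h1]

theorem star_mul_self_idem (s : S) : star s * s * (star s * s) = star s * s := by
  rw [← mul_assoc, star_mul_star_self]

theorem mul_star_self_idem (s : S) : s * star s * (s * star s) = s * star s := by
  rw [← mul_assoc, mul_star_mul]

theorem star_mul_rev (s t : S) : star (s * t) = star t * star s := by
  have hc := idem_comm (mul_star_self_idem t) (star_mul_self_idem s)
  refine (eq_star _ _ ?_ ?_).symm
  · calc s * t * (star t * star s) * (s * t)
        = s * ((t * star t) * (star s * s)) * t := by simp only [mul_assoc]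
      _ = (s * star s * s) * (t * star t * t) := by rw [hc]; simp only [mul_assoc]
      _ = s * t := by rw [mul_star_mul, mul_star_mul]
  · calc star t * star s * (s * t) * (star t * star s)
        = star t * ((star s * s) * (t * star t)) * star s := by simp only [mul_assoc]
      _ = (star t * t * star t) * (star s * s * star s) := by
          rw [← hc]; simp only [mul_assoc]
      _ = star t * star s := by rw [star_mul_star_self, star_mul_star_self]

theorem conj_idem (s : S) {e : S} (he : e * e = e) :
    s * e * star s * (s * e * star s) = s * e * star s := by
  have hc := idem_comm he (star_mul_self_idem s)
  calc s * e * star s * (s * e * star s)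
      = s * (e * (star s * s)) * e * star s := by simp only [mul_assoc]
    _ = (s * star s * s) * (e * e) * star s := by rw [hc]; simp only [mul_assoc]
    _ = s * e * star s := by rw [mul_star_mul, he]

end InverseSemigroupWithZero

section TightGroupoid

variable {S : Type*} [InverseSemigroupWithZero S]

open InverseSemigroupWithZero

/-- The natural partial order of an inverse semigroup. -/
def NatLE (s t : S) : Prop := ∃ e, IsIdempotentElem e ∧ s = t * e

/-- Filters in the semilattice `𝓔(S)` of idempotents. -/
structure IsIdemFilter (F : Set S) : Prop where
  idem : ∀ e ∈ F, IsIdempotentElem e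
  nonempty : F.Nonempty
  mul_mem : ∀ e ∈ F, ∀ f ∈ F, e * f ∈ F
  up : ∀ e ∈ F, ∀ f, IsIdempotentElem f → NatLE e f → f ∈ F

variable (S) in
/-- The set of all filters in `𝓔(S)` that do not contain zero. -/
def ProperFilter : Type _ := {F : Set S // IsIdemFilter F ∧ 0 ∉ F}

/-- The topology generated by the sets `N(e; e₁, …, eₙ)` of all filters that contain `e` and none
of `e₁, …, eₙ`. -/
instance : TopologicalSpace (ProperFilter S) :=
  TopologicalSpace.generateFrom
    {U | ∃ (e : S) (Y : Finset S), IsIdempotentElem e ∧ (∀ f ∈ Y, IsIdempotentElem f) ∧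
      U = {F : ProperFilter S | e ∈ F.1 ∧ ∀ f ∈ Y, f ∉ F.1}}

variable (S) in
/-- The set of all ultrafilters: the maximal proper filters in `𝓔(S)`. -/
def ultraFilters : Set (ProperFilter S) := {F | ∀ H : ProperFilter S, F.1 ⊆ H.1 → H = F}

variable (S) in
/-- The tight spectrum: the closure of the set of ultrafilters, with the subspace topology. -/
def TightSpectrum : Type _ := {F : ProperFilter S // F ∈ closure (ultraFilters S)}

instance : TopologicalSpace (TightSpectrum S) :=
  inferInstanceAs (TopologicalSpace {F : ProperFilter S // F ∈ closure (ultraFilters S)})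

/-- `(s F s^*)↑`, the set of all idempotents above some `s e s^*` with `e ∈ F`. -/
def conjSet (s : S) (F : Set S) : Set S :=
  {t | IsIdempotentElem t ∧ ∃ e ∈ F, NatLE (s * e * star s) t}

theorem star_conj_idem (s : S) {e : S} (he : IsIdempotentElem e) :
    IsIdempotentElem (star s * e * s) := by
  have h := conj_idem (star s) he
  rwa [star_star'] at h

namespace IsIdemFilter

variable {F : Set S}

theorem left_mem (hF : IsIdemFilter F) {e f : S} (he : IsIdempotentElem e)
    (hf : IsIdempotentElem f) (h : e * f ∈ F) : e ∈ F := hF.up _ h e he ⟨f, hf, rfl⟩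

theorem right_mem (hF : IsIdemFilter F) {e f : S} (he : IsIdempotentElem e)
    (hf : IsIdempotentElem f) (h : e * f ∈ F) : f ∈ F := hF.up _ h f hf ⟨e, he, idem_comm he hf⟩

theorem mem_conjSet (hF : IsIdemFilter F) {s t : S} (hs : star s * s ∈ F) (ht : IsIdempotentElem t) :
    t ∈ conjSet s F ↔ star s * t * s ∈ F := by
  constructor
  · rintro ⟨-, e, he, k, hk, h⟩
    have h1 : t * (s * e * star s) = s * e * star s := by
      rw [h, ← mul_assoc, ht.eq]
    have hc := idem_comm (hF.idem _ he) (star_mul_self_idem s)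
    refine hF.up _ (hF.mul_mem _ he _ hs) _ (star_conj_idem s ht)
      ⟨e * (star s * s), hF.idem _ (hF.mul_mem _ he _ hs), ?_⟩
    calc e * (star s * s) = star s * s * (star s * s) * e := by rw [star_mul_self_idem, hc]
      _ = star s * (s * e * star s) * s := by
          rw [mul_assoc (star s * s), ← hc]; simp only [mul_assoc]
      _ = star s * t * s * (e * (star s * s)) := by rw [← h1]; simp only [mul_assoc]
  · intro h
    refine ⟨ht, _, h, s * star s, mul_star_self_idem s, ?_⟩
    calc s * (star s * t * s) * star s = (s * star s * t) * (s * star s) := by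
          simp only [mul_assoc]
      _ = t * (s * star s) := by
          rw [idem_comm (mul_star_self_idem s) ht, mul_assoc, mul_star_self_idem]

theorem conj_mul (s : S) {t t' : S} (ht : IsIdempotentElem t) :
    star s * t * s * (star s * t' * s) = star s * (t * t') * s := by
  calc star s * t * s * (star s * t' * s)
      = star s * (t * (s * star s)) * t' * s := by simp only [mul_assoc]
    _ = (star s * s * star s) * t * t' * s := by
        rw [idem_comm ht (mul_star_self_idem s)]; simp only [mul_assoc]
    _ = star s * (t * t') * s := by rw [star_mul_star_self]; simp only [mul_assoc]

theorem conj (hF : IsIdemFilter F) {s : S} (hs : star s * s ∈ F) : IsIdemFilter (conjSet s F) where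
  idem e he := he.1
  nonempty := by
    refine ⟨s * star s, (hF.mem_conjSet hs (mul_star_self_idem s)).2 ?_⟩
    rw [← mul_assoc, star_mul_star_self]
    exact hs
  mul_mem e he f hf := by
    have h1 := (hF.mem_conjSet hs he.1).1 he
    have h2 := (hF.mem_conjSet hs hf.1).1 hf
    refine (hF.mem_conjSet hs (idem_mul he.1 hf.1)).2 ?_
    rw [← conj_mul s he.1]
    exact hF.mul_mem _ h1 _ h2
  up e he f hf h := by
    have h1 := (hF.mem_conjSet hs he.1).1 he
    refine (hF.mem_conjSet hs hf).2 ?_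
    obtain ⟨k, hk, rfl⟩ := h
    rw [← conj_mul s hf] at h1
    exact hF.left_mem (star_conj_idem s hf) (star_conj_idem s hk) h1

end IsIdemFilter

namespace ProperFilter

/-- The filter `(s F s^*)↑` for a filter `F` that contains `s^* s`. -/
def conj (s : S) (F : ProperFilter S) (hs : star s * s ∈ F.1) : ProperFilter S :=
  ⟨conjSet s F.1, F.2.1.conj hs, fun h => F.2.2 (by
    have h1 := (F.2.1.mem_conjSet hs h.1).1 h
    rwa [mul_zero, zero_mul] at h1)⟩

theorem mem_conj {s : S} {F : ProperFilter S} (hs : star s * s ∈ F.1) {t : S}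
    (ht : IsIdempotentElem t) : t ∈ (F.conj s hs).1 ↔ star s * t * s ∈ F.1 :=
  F.2.1.mem_conjSet hs ht

theorem ext_idem {F H : ProperFilter S} (h : ∀ t, IsIdempotentElem t → (t ∈ F.1 ↔ t ∈ H.1)) :
    F = H :=
  Subtype.ext (Set.ext fun t =>
    ⟨fun ht => (h t (F.2.1.idem t ht)).1 ht, fun ht => (h t (H.2.1.idem t ht)).2 ht⟩)

theorem mul_star_mem_conj {s : S} {F : ProperFilter S} (hs : star s * s ∈ F.1) :
    s * star s ∈ (F.conj s hs).1 := by
  rw [mem_conj hs (mul_star_self_idem s), ← mul_assoc, star_mul_star_self]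
  exact hs

theorem star_mem_conj {s : S} {F : ProperFilter S} (hs : star s * s ∈ F.1) :
    star (star s) * star s ∈ (F.conj s hs).1 := by
  rw [star_star']
  exact mul_star_mem_conj hs

theorem conj_conj {s : S} {F : ProperFilter S} (hs : star s * s ∈ F.1) :
    (F.conj s hs).conj (star s) (star_mem_conj hs) = F := by
  refine ext_idem fun t ht => ?_
  have h1 : IsIdempotentElem (s * t * star s) := conj_idem s ht
  rw [mem_conj _ ht, star_star', mem_conj _ h1]
  have h2 : star s * (s * t * star s) * s = t * (star s * s) := by
    calc star s * (s * t * star s) * s = (star s * s * t) * (star s * s) := by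
          simp only [mul_assoc]
      _ = t * (star s * s) := by
          rw [idem_comm (star_mul_self_idem s) ht, mul_assoc, star_mul_self_idem]
  rw [h2]
  exact ⟨fun h => F.2.1.left_mem ht (star_mul_self_idem s) h, fun h => F.2.1.mul_mem _ h _ hs⟩

theorem conj_mono {s : S} {F H : ProperFilter S} (hs : star s * s ∈ F.1) (h : F.1 ⊆ H.1) :
    (F.conj s hs).1 ⊆ (H.conj s (h hs)).1 := by
  intro t ht
  have hi := (F.conj s hs).2.1.idem t ht
  exact (mem_conj _ hi).2 (h ((mem_conj hs hi).1 ht))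

theorem conj_ultra {s : S} {F : ProperFilter S} (hs : star s * s ∈ F.1)
    (hF : F ∈ ultraFilters S) : F.conj s hs ∈ ultraFilters S := by
  intro H hH
  have h1 := conj_mono (star_mem_conj hs) hH
  rw [conj_conj] at h1
  have h2 := hF _ h1
  have h3 := conj_conj (hH (star_mem_conj hs))
  rw [← h3]
  have key : ∀ (a b : S) (K L : ProperFilter S) (ha : star a * a ∈ K.1) (hb : star b * b ∈ L.1),
      a = b → K = L → K.conj a ha = L.conj b hb := by
    rintro a b K L ha hb rfl rfl
    rfl
  exact key _ _ _ _ _ _ (star_star' s) h2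

theorem isOpen_basic {e : S} {Y : Finset S} (he : IsIdempotentElem e)
    (hY : ∀ f ∈ Y, IsIdempotentElem f) :
    IsOpen {F : ProperFilter S | e ∈ F.1 ∧ ∀ f ∈ Y, f ∉ F.1} :=
  TopologicalSpace.isOpen_generateFrom_of_mem ⟨e, Y, he, hY, rfl⟩

theorem isOpen_mem {e : S} (he : IsIdempotentElem e) : IsOpen {F : ProperFilter S | e ∈ F.1} := by
  have h := isOpen_basic (Y := ∅) he (by simp)
  simpa using h

theorem continuous_conj (s : S) :
    Continuous (fun F : {F : ProperFilter S // star s * s ∈ F.1} => F.1.conj s F.2) := by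
  classical
  refine continuous_generateFrom_iff.2 ?_
  rintro _ ⟨e, Y, he, hY, rfl⟩
  have h : IsOpen {F : ProperFilter S | star s * e * s ∈ F.1 ∧
      ∀ f ∈ Y.image (fun f => star s * f * s), f ∉ F.1} := by
    refine isOpen_basic (star_conj_idem s he) fun f hf => ?_
    obtain ⟨f', hf', rfl⟩ := Finset.mem_image.1 hf
    exact star_conj_idem s (hY _ hf')
  convert h.preimage continuous_subtype_val using 1
  ext F
  simp only [Set.mem_preimage, Set.mem_ofPred_eq, Finset.forall_mem_image]
  rw [mem_conj F.2 he]
  refine and_congr_right fun _ => forall₂_congr fun f hf => ?_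
  rw [mem_conj F.2 (hY f hf)]

theorem conj_tight {s : S} {F : ProperFilter S} (hs : star s * s ∈ F.1)
    (hF : F ∈ closure (ultraFilters S)) : F.conj s hs ∈ closure (ultraFilters S) := by
  rw [mem_closure_iff] at hF ⊢
  intro O hO hFO
  obtain ⟨O', hO', h⟩ := isOpen_induced_iff.1 (hO.preimage (continuous_conj s))
  have hmem : ∀ (K : ProperFilter S) (hK : star s * s ∈ K.1), K ∈ O' ↔ K.conj s hK ∈ O := by
    intro K hK
    have := Set.ext_iff.1 h ⟨K, hK⟩
    exact this
  obtain ⟨K, ⟨hK1, hK2⟩, hK3⟩ := hF _ (hO'.inter (isOpen_mem (star_mul_self_idem s)))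
    ⟨(hmem F hs).2 hFO, hs⟩
  exact ⟨_, (hmem K hK2).1 hK1, conj_ultra hK2 hK3⟩

end ProperFilter

namespace TightSpectrum

/-- The action `θ_s : D^{s^*s} → D^{ss^*}`, `θ_s(F) = (s F s^*)↑`, on tight filters. -/
def θ (s : S) (F : TightSpectrum S) (hs : star s * s ∈ F.1.1) : TightSpectrum S :=
  ⟨F.1.conj s hs, ProperFilter.conj_tight hs F.2⟩

theorem mem_θ {s : S} {F : TightSpectrum S} (hs : star s * s ∈ F.1.1) {t : S}
    (ht : IsIdempotentElem t) : t ∈ (θ s F hs).1.1 ↔ star s * t * s ∈ F.1.1 :=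
  ProperFilter.mem_conj hs ht

theorem ext_idem {F H : TightSpectrum S}
    (h : ∀ t, IsIdempotentElem t → (t ∈ F.1.1 ↔ t ∈ H.1.1)) : F = H :=
  Subtype.ext (ProperFilter.ext_idem h)

theorem mul_mem_iff (F : TightSpectrum S) {e f : S} (he : IsIdempotentElem e)
    (hf : IsIdempotentElem f) : e * f ∈ F.1.1 ↔ e ∈ F.1.1 ∧ f ∈ F.1.1 :=
  ⟨fun h => ⟨F.1.2.1.left_mem he hf h, F.1.2.1.right_mem he hf h⟩,
    fun h => F.1.2.1.mul_mem _ h.1 _ h.2⟩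

theorem star_mem_θ {s : S} {F : TightSpectrum S} (hs : star s * s ∈ F.1.1) :
    star (star s) * star s ∈ (θ s F hs).1.1 := ProperFilter.star_mem_conj hs

theorem θ_star_θ {s : S} {F : TightSpectrum S} (hs : star s * s ∈ F.1.1) :
    θ (star s) (θ s F hs) (star_mem_θ hs) = F := Subtype.ext (ProperFilter.conj_conj hs)

theorem idem_mem {e : S} {F : TightSpectrum S} (he : IsIdempotentElem e) (h : e ∈ F.1.1) :
    star e * e ∈ F.1.1 := by rwa [star_of_idem he, he.eq]

theorem θ_idem {e : S} {F : TightSpectrum S} (he : IsIdempotentElem e)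
    (hs : star e * e ∈ F.1.1) : θ e F hs = F := by
  have h : e ∈ F.1.1 := by rwa [star_of_idem he, he.eq] at hs
  refine ext_idem fun t ht => ?_
  rw [mem_θ hs ht, star_of_idem he, F.mul_mem_iff (idem_mul he ht) he, F.mul_mem_iff he ht]
  tauto

theorem mul_mem_of_θ {s t : S} {F : TightSpectrum S} (hs : star s * s ∈ F.1.1)
    (ht : star t * t ∈ (θ s F hs).1.1) : star (t * s) * (t * s) ∈ F.1.1 := by
  rw [mem_θ hs (star_mul_self_idem t)] at ht
  rw [star_mul_rev]
  simpa only [mul_assoc] using ht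

theorem θ_θ {s t : S} {F : TightSpectrum S} (hs : star s * s ∈ F.1.1)
    (ht : star t * t ∈ (θ s F hs).1.1) :
    θ t (θ s F hs) ht = θ (t * s) F (mul_mem_of_θ hs ht) := by
  refine ext_idem fun e he => ?_
  rw [mem_θ ht he, mem_θ hs (star_conj_idem t he), mem_θ _ he, star_mul_rev]
  simp only [mul_assoc]

/-- Elements with the same germ at `F` act in the same way on `F`. -/
theorem θ_congr {s t e : S} {F : TightSpectrum S} (hs : star s * s ∈ F.1.1)
    (ht : star t * t ∈ F.1.1) (he : e ∈ F.1.1) (h : s * e = t * e) : θ s F hs = θ t F ht := by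
  have hei : IsIdempotentElem e := F.1.2.1.idem e he
  have key : ∀ (s : S) (k : S), IsIdempotentElem k →
      (star s * k * s ∈ F.1.1 ↔ star (s * e) * k * (s * e) ∈ F.1.1) := by
    intro s k hk
    have h1 : star (s * e) * k * (s * e) = e * ((star s * k * s) * e) := by
      rw [star_mul_rev, star_of_idem hei]; simp only [mul_assoc]
    rw [h1, F.mul_mem_iff hei (idem_mul (star_conj_idem s hk) hei),
      F.mul_mem_iff (star_conj_idem s hk) hei]
    tauto
  refine ext_idem fun k hk => ?_
  rw [mem_θ hs hk, mem_θ ht hk, key s k hk, key t k hk, h]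

end TightSpectrum

variable (S) in
/-- The pairs `(s, F)` of an element of `S` and a tight filter with `s^* s ∈ F`. -/
def PreGerm : Type _ := {p : S × TightSpectrum S // star p.1 * p.1 ∈ p.2.1.1}

/-- `(s, F) ∼ (t, F')` if `F = F'` and `s e = t e` for some `e ∈ F`. -/
instance germSetoid : Setoid (PreGerm S) where
  r p q := p.1.2 = q.1.2 ∧ ∃ e ∈ p.1.2.1.1, p.1.1 * e = q.1.1 * e
  iseqv :=
    { refl := fun p => ⟨rfl, _, p.2, rfl⟩
      symm := by
        rintro p q ⟨h, e, he, h1⟩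
        exact ⟨h.symm, e, h ▸ he, h1.symm⟩
      trans := by
        rintro p q k ⟨h, e, he, h1⟩ ⟨h', f, hf, h2⟩
        rw [← h] at hf
        refine ⟨h.trans h', e * f, p.1.2.1.2.1.mul_mem _ he _ hf, ?_⟩
        have hc := idem_comm (p.1.2.1.2.1.idem e he) (p.1.2.1.2.1.idem f hf)
        rw [← mul_assoc, h1, mul_assoc, hc, ← mul_assoc, h2, mul_assoc] }

variable (S) in
/-- The set of germs `[s, F]`, i.e. the set of arrows of the tight groupoid. -/
def TightGerm : Type _ := Quotient (germSetoid (S := S))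

namespace TightGerm

open TightSpectrum

/-- The germ `[s, F]`. -/
def mk (s : S) (F : TightSpectrum S) (hs : star s * s ∈ F.1.1) : TightGerm S :=
  Quotient.mk _ ⟨(s, F), hs⟩

/-- `[s, V] = {[s, F] : F ∈ V}` (over those `F ∈ V` for which `[s, F]` is defined). -/
def bracket (s : S) (V : Set (TightSpectrum S)) : Set (TightGerm S) :=
  {x | ∃ F ∈ V, ∃ hs : star s * s ∈ F.1.1, x = mk s F hs}

/-- The topology generated by the sets `[s, V]` with `V` open. -/
instance : TopologicalSpace (TightGerm S) :=
  TopologicalSpace.generateFrom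
    {U | ∃ (s : S) (V : Set (TightSpectrum S)), IsOpen V ∧ U = bracket s V}

theorem ind {P : TightGerm S → Prop} (h : ∀ s F hs, P (mk s F hs)) (x : TightGerm S) : P x := by
  induction x using Quotient.inductionOn with
  | h p => exact h p.1.1 p.1.2 p.2

theorem mk_eq_mk {s t : S} {F H : TightSpectrum S} {hs : star s * s ∈ F.1.1}
    {ht : star t * t ∈ H.1.1} :
    mk s F hs = mk t H ht ↔ F = H ∧ ∃ e ∈ F.1.1, s * e = t * e := Quotient.eq

theorem mk_congr {s t : S} {F H : TightSpectrum S} {hs : star s * s ∈ F.1.1}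
    {ht : star t * t ∈ H.1.1} (h1 : s = t) (h2 : F = H) : mk s F hs = mk t H ht := by
  subst h1 h2
  rfl

theorem mk_idem_eq {e f : S} {F : TightSpectrum S} {he : star e * e ∈ F.1.1}
    {hf : star f * f ∈ F.1.1} (he' : IsIdempotentElem e) (hf' : IsIdempotentElem f) :
    mk e F he = mk f F hf := by
  have h1 : e ∈ F.1.1 := by rwa [star_of_idem he', he'.eq] at he
  have h2 : f ∈ F.1.1 := by rwa [star_of_idem hf', hf'.eq] at hf
  refine mk_eq_mk.2 ⟨rfl, e * f, F.1.2.1.mul_mem _ h1 _ h2, ?_⟩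
  rw [← mul_assoc, he'.eq, idem_comm he' hf', ← mul_assoc, hf'.eq]

/-- `s([s, F]) = [s^* s, F]`. -/
def source (x : TightGerm S) : TightGerm S :=
  Quotient.lift (fun p : PreGerm S =>
    mk (star p.1.1 * p.1.1) p.1.2 (idem_mem (star_mul_self_idem _) p.2))
    (by
      rintro ⟨⟨s, F⟩, hs⟩ ⟨⟨t, H⟩, ht⟩ ⟨h, -⟩
      obtain rfl : F = H := h
      exact mk_idem_eq (star_mul_self_idem _) (star_mul_self_idem _)) x

/-- `r([s, F]) = [s s^*, θ_s(F)]`. -/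
def range (x : TightGerm S) : TightGerm S :=
  Quotient.lift (fun p : PreGerm S =>
    mk (p.1.1 * star p.1.1) (θ p.1.1 p.1.2 p.2)
      (idem_mem (mul_star_self_idem _) (ProperFilter.mul_star_mem_conj p.2)))
    (by
      rintro ⟨⟨s, F⟩, hs⟩ ⟨⟨t, H⟩, ht⟩ ⟨h, e, he, h1⟩
      obtain rfl : F = H := h
      have h2 : θ s F hs = θ t F ht := θ_congr hs ht he h1
      have h3 := ProperFilter.mul_star_mem_conj ht
      refine (mk_congr rfl h2).trans (mk_idem_eq (F := θ t F ht) (he := ?_)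
        (mul_star_self_idem _) (mul_star_self_idem _))
      rw [← h2]
      exact idem_mem (mul_star_self_idem _) (ProperFilter.mul_star_mem_conj hs)) x

/-- `[s, F]⁻¹ = [s^*, θ_s(F)]`. -/
def inv (x : TightGerm S) : TightGerm S :=
  Quotient.lift (fun p : PreGerm S => mk (star p.1.1) (θ p.1.1 p.1.2 p.2) (star_mem_θ p.2))
    (by
      rintro ⟨⟨s, F⟩, hs⟩ ⟨⟨t, H⟩, ht⟩ ⟨h, e, he, h1⟩
      obtain rfl : F = H := h
      have hei : IsIdempotentElem e := F.1.2.1.idem e he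
      have h1' : s * e = t * e := h1
      refine mk_eq_mk.2 ⟨θ_congr hs ht he h1, s * e * star s, ?_, ?_⟩
      · refine (mem_θ hs (conj_idem s hei)).2 ?_
        have : star s * (s * e * star s) * s = (star s * s) * (e * (star s * s)) := by
          simp only [mul_assoc]
        rw [this]
        exact F.1.2.1.mul_mem _ hs _ (F.1.2.1.mul_mem _ he _ hs)
      · have key : ∀ u : S, star u * (u * e * star u) = e * star u := by
          intro u
          calc star u * (u * e * star u) = (star u * u * e) * star u := by
                simp only [mul_assoc]
            _ = e * (star u * u * star u) := by
                rw [idem_comm (star_mul_self_idem u) hei]; simp only [mul_assoc]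
            _ = e * star u := by rw [star_mul_star_self]
        have h2 : e * star s = e * star t := by
          have := congrArg star h1'
          rwa [star_mul_rev, star_mul_rev, star_of_idem hei] at this
        have h3 : s * e * star s = t * e * star t := by
          rw [h1', mul_assoc, h2, ← mul_assoc]
        change star s * (s * e * star s) = star t * (s * e * star s)
        rw [key s, h3, key t, h2]) x

theorem source_mk (s : S) (F : TightSpectrum S) (hs : star s * s ∈ F.1.1) :
    source (mk s F hs) = mk (star s * s) F (idem_mem (star_mul_self_idem _) hs) := rfl

theorem range_mk (s : S) (F : TightSpectrum S) (hs : star s * s ∈ F.1.1) :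
    range (mk s F hs) = mk (s * star s) (θ s F hs)
      (idem_mem (mul_star_self_idem _) (ProperFilter.mul_star_mem_conj hs)) := rfl

theorem inv_mk (s : S) (F : TightSpectrum S) (hs : star s * s ∈ F.1.1) :
    inv (mk s F hs) = mk (star s) (θ s F hs) (star_mem_θ hs) := rfl

theorem source_eq_range {s t : S} {F H : TightSpectrum S} {hs : star s * s ∈ F.1.1}
    {ht : star t * t ∈ H.1.1} : source (mk t H ht) = range (mk s F hs) ↔ H = θ s F hs := by
  rw [source_mk, range_mk]
  refine ⟨fun h => (mk_eq_mk.1 h).1, ?_⟩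
  rintro rfl
  exact mk_idem_eq (star_mul_self_idem _) (mul_star_self_idem _)

/-- The graph of the multiplication: `[t, θ_s(F)] [s, F] = [t s, F]`. -/
def IsMul (x y z : TightGerm S) : Prop :=
  ∃ (t s : S) (F : TightSpectrum S) (hs : star s * s ∈ F.1.1)
    (ht : star t * t ∈ (θ s F hs).1.1),
    x = mk t (θ s F hs) ht ∧ y = mk s F hs ∧ z = mk (t * s) F (mul_mem_of_θ hs ht)

theorem exists_isMul {x y : TightGerm S} (h : source x = range y) : ∃ z, IsMul x y z := by
  induction x using ind with
  | h t H ht =>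
    induction y using ind with
    | h s F hs =>
      obtain rfl := source_eq_range.1 h
      exact ⟨_, t, s, F, hs, ht, rfl, rfl, rfl⟩

theorem IsMul.unique {x y z z' : TightGerm S} (h : IsMul x y z) (h' : IsMul x y z') : z = z' := by
  obtain ⟨t, s, F, hs, ht, rfl, rfl, rfl⟩ := h
  obtain ⟨t', s', F', hs', ht', h1, h2, rfl⟩ := h'
  obtain ⟨rfl, e, he, h3⟩ := mk_eq_mk.1 h2
  obtain ⟨-, f, hf, h4⟩ := mk_eq_mk.1 h1
  have hei : IsIdempotentElem e := F.1.2.1.idem e he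
  have hfi : IsIdempotentElem f := (θ s F hs).1.2.1.idem f hf
  have hf' := (mem_θ hs hfi).1 hf
  have hki := star_conj_idem s hfi
  refine mk_eq_mk.2 ⟨rfl, e * (star s * f * s), F.1.2.1.mul_mem _ he _ hf', ?_⟩
  have key : s * (star s * f * s) = f * s := by
    calc s * (star s * f * s) = (s * star s * f) * s := by simp only [mul_assoc]
      _ = f * (s * star s * s) := by
          rw [idem_comm (mul_star_self_idem s) hfi]; simp only [mul_assoc]
      _ = f * s := by rw [mul_star_mul]
  have h5 : s * (e * (star s * f * s)) = f * (s * e) := by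
    rw [idem_comm hei hki, ← mul_assoc, key, mul_assoc]
  have h6 : s' * (e * (star s * f * s)) = s * (e * (star s * f * s)) := by
    rw [← mul_assoc, ← h3, mul_assoc]
  rw [mul_assoc t, mul_assoc t', h6, h5, ← mul_assoc, h4, mul_assoc]

/-- The product of two composable germs. -/
noncomputable def mul (x y : TightGerm S) (h : source x = range y) : TightGerm S :=
  (exists_isMul h).choose

theorem mul_mk (t s : S) (F : TightSpectrum S) (hs : star s * s ∈ F.1.1)
    (ht : star t * t ∈ (θ s F hs).1.1) (h : source (mk t (θ s F hs) ht) = range (mk s F hs)) :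
    mul (mk t (θ s F hs) ht) (mk s F hs) h = mk (t * s) F (mul_mem_of_θ hs ht) :=
  (exists_isMul h).choose_spec.unique ⟨t, s, F, hs, ht, rfl, rfl, rfl⟩

theorem exists_rep {x y : TightGerm S} (h : source x = range y) :
    ∃ (t s : S) (F : TightSpectrum S) (hs : star s * s ∈ F.1.1)
      (ht : star t * t ∈ (θ s F hs).1.1), x = mk t (θ s F hs) ht ∧ y = mk s F hs := by
  obtain ⟨_, t, s, F, hs, ht, h1, h2, -⟩ := exists_isMul h
  exact ⟨t, s, F, hs, ht, h1, h2⟩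

theorem mul_eq {x y z : TightGerm S} (h : source x = range y) (hz : IsMul x y z) :
    mul x y h = z :=
  (exists_isMul h).choose_spec.unique hz

theorem source_inv (x : TightGerm S) : source (inv x) = range x := by
  induction x using ind with
  | h s F hs => exact mk_congr (by rw [star_star']) rfl

theorem range_inv (x : TightGerm S) : range (inv x) = source x := by
  induction x using ind with
  | h s F hs => exact mk_congr (by rw [star_star']) (θ_star_θ hs)

theorem isMul_range_self (x : TightGerm S) : IsMul (range x) x x := by
  induction x using ind with
  | h s F hs =>
    exact ⟨_, s, F, hs, _, rfl, rfl, mk_congr (mul_star_mul s).symm rfl⟩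

theorem isMul_source_self (x : TightGerm S) : IsMul x (source x) x := by
  induction x using ind with
  | h s F hs =>
    have h := θ_idem (star_mul_self_idem s) (idem_mem (star_mul_self_idem s) hs)
    exact ⟨s, _, F, idem_mem (star_mul_self_idem s) hs, h.symm ▸ hs, mk_congr rfl h.symm, rfl,
      mk_congr (by rw [← mul_assoc, mul_star_mul]) rfl⟩

theorem isMul_inv_self (x : TightGerm S) : IsMul (inv x) x (source x) := by
  induction x using ind with
  | h s F hs => exact ⟨_, s, F, hs, _, rfl, rfl, rfl⟩

theorem isMul_self_inv (x : TightGerm S) : IsMul x (inv x) (range x) := by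
  induction x using ind with
  | h s F hs =>
    have h := θ_star_θ hs
    exact ⟨s, star s, θ s F hs, star_mem_θ hs, h.symm ▸ hs, mk_congr rfl h.symm, rfl, rfl⟩

theorem source_source (x : TightGerm S) : source (source x) = source x := by
  induction x using ind with
  | h s F hs => exact mk_idem_eq (star_mul_self_idem _) (star_mul_self_idem _)

theorem source_range (x : TightGerm S) : source (range x) = range x := by
  rw [← source_inv, source_source]

theorem range_source (x : TightGerm S) : range (source x) = source x := by
  induction x using ind with
  | h s F hs =>
    refine (mk_congr rfl (θ_idem (star_mul_self_idem s) _)).trans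
      (mk_idem_eq (F := F) (he := ?_) (mul_star_self_idem _) (star_mul_self_idem _))
    rw [star_of_idem (star_mul_self_idem s), star_mul_self_idem]
    exact idem_mem (star_mul_self_idem s) hs

theorem source_mul (x y : TightGerm S) (h : source x = range y) :
    source (mul x y h) = source y := by
  obtain ⟨t, s, F, hs, ht, rfl, rfl⟩ := exists_rep h
  rw [mul_mk]
  exact mk_idem_eq (star_mul_self_idem _) (star_mul_self_idem _)

theorem range_mul (x y : TightGerm S) (h : source x = range y) :
    range (mul x y h) = range x := by
  obtain ⟨t, s, F, hs, ht, rfl, rfl⟩ := exists_rep h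
  rw [mul_mk, range_mk, range_mk]
  refine (mk_congr rfl (θ_θ hs ht).symm).trans
    (mk_idem_eq (F := θ t (θ s F hs) ht) (he := ?_) (mul_star_self_idem _) (mul_star_self_idem _))
  rw [θ_θ hs ht]
  exact idem_mem (mul_star_self_idem _) (ProperFilter.mul_star_mem_conj (mul_mem_of_θ hs ht))

theorem mul_assoc' (x y z : TightGerm S) (h : source x = range y) (h' : source y = range z)
    (h1 : source (mul x y h) = range z) (h2 : source x = range (mul y z h')) :
    mul (mul x y h) z h1 = mul x (mul y z h') h2 := by
  obtain ⟨t, u, F, hu, ht, rfl, rfl⟩ := exists_rep h'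
  induction x using ind with
  | h s H hs =>
    obtain rfl := source_eq_range.1 h
    have e1 := mul_mk s t (θ u F hu) ht hs h
    have e2 := mul_mk t u F hu ht h'
    have hs' : star s * s ∈ (θ (t * u) F (mul_mem_of_θ hu ht)).1.1 := θ_θ hu ht ▸ hs
    have e3 : mul (mul (mk s (θ t (θ u F hu) ht) hs) (mk t (θ u F hu) ht) h) (mk u F hu) h1 =
        mk (s * t * u) F (mul_mem_of_θ hu (mul_mem_of_θ ht hs)) :=
      mul_eq _ ⟨s * t, u, F, hu, mul_mem_of_θ ht hs, e1, rfl, rfl⟩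
    have e4 : mul (mk s (θ t (θ u F hu) ht) hs) (mul (mk t (θ u F hu) ht) (mk u F hu) h') h2 =
        mk (s * (t * u)) F (mul_mem_of_θ (mul_mem_of_θ hu ht) hs') :=
      mul_eq _ ⟨s, t * u, F, mul_mem_of_θ hu ht, hs', mk_congr rfl (θ_θ hu ht), e2, rfl⟩
    rw [e3, e4]
    exact mk_congr (mul_assoc s t u) rfl

end TightGerm

end TightGroupoid

/-- A groupoid, given by its set `Γ` of arrows: `x y` is defined if and only if the source of `x` is
the range of `y`, and the units are identified with the identity arrows. -/
structure ArrowGroupoid (Γ : Type*) where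
  range : Γ → Γ
  source : Γ → Γ
  inv : Γ → Γ
  mul : ∀ x y : Γ, source x = range y → Γ
  range_mul : ∀ x y h, range (mul x y h) = range x
  source_mul : ∀ x y h, source (mul x y h) = source y
  mul_assoc : ∀ x y z (h : source x = range y) (h' : source y = range z),
    mul (mul x y h) z ((source_mul x y h).trans h') =
      mul x (mul y z h') (h.trans (range_mul y z h').symm)
  range_inv : ∀ x, range (inv x) = source x
  source_inv : ∀ x, source (inv x) = range x
  mul_inv : ∀ x, mul x (inv x) (range_inv x).symm = range x
  inv_mul : ∀ x, mul (inv x) x (source_inv x) = source x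
  source_range : ∀ x, source (range x) = range x
  range_source : ∀ x, range (source x) = source x
  range_mul_self : ∀ x, mul (range x) x (source_range x) = x
  mul_source_self : ∀ x, mul x (source x) (range_source x).symm = x

namespace ArrowGroupoid

variable {Γ : Type*} (𝒢 : ArrowGroupoid Γ)

/-- The unit space `𝒢⁽⁰⁾ = {x⁻¹ x : x ∈ 𝒢}`. -/
def units : Set Γ := {u | ∃ x, u = 𝒢.mul (𝒢.inv x) x (𝒢.source_inv x)}

/-- The range map as a map to the unit space. -/
def rangeMap (x : Γ) : 𝒢.units :=
  ⟨𝒢.range x, 𝒢.inv x, by rw [𝒢.inv_mul, 𝒢.source_inv]⟩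

/-- The source map as a map to the unit space. -/
def sourceMap (x : Γ) : 𝒢.units := ⟨𝒢.source x, x, (𝒢.inv_mul x).symm⟩

variable [TopologicalSpace Γ]

/-- Topological groupoids: all structure maps are continuous; the multiplication is considered on
the subspace of composable pairs of `Γ × Γ`. -/
structure IsTopological : Prop where
  continuous_mul : Continuous
    (fun p : {p : Γ × Γ // 𝒢.source p.1 = 𝒢.range p.2} => 𝒢.mul p.1.1 p.1.2 p.2)
  continuous_inv : Continuous 𝒢.inv
  continuous_range : Continuous 𝒢.range
  continuous_source : Continuous 𝒢.source

/-- Étale groupoids: locally compact topological groupoids whose range and source maps are local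
homeomorphisms onto the unit space, which carries the subspace topology. -/
structure IsEtale : Prop extends 𝒢.IsTopological where
  locallyCompact : LocallyCompactSpace Γ
  isLocalHomeomorph_range : IsLocalHomeomorph 𝒢.rangeMap
  isLocalHomeomorph_source : IsLocalHomeomorph 𝒢.sourceMap

/-- Bisections: the restrictions of the range map and the source map are homeomorphisms onto their
images. -/
structure IsBisection (B : Set Γ) : Prop where
  range : Topology.IsEmbedding (B.domRestrict 𝒢.rangeMap)
  source : Topology.IsEmbedding (B.domRestrict 𝒢.sourceMap)

/-- Ample groupoids: étale groupoids with a basis of compact open bisections. -/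
structure IsAmple : Prop extends 𝒢.IsEtale where
  exists_basis : ∃ 𝓑 : Set (Set Γ), TopologicalSpace.IsTopologicalBasis 𝓑 ∧
    ∀ B ∈ 𝓑, IsCompact B ∧ IsOpen B ∧ 𝒢.IsBisection B

end ArrowGroupoid

section TightGroupoid

open InverseSemigroupWithZero TightGerm TightSpectrum

variable (S : Type*) [InverseSemigroupWithZero S]

/-- The tight groupoid of an inverse semigroup with zero. -/
noncomputable def tightGroupoid : ArrowGroupoid (TightGerm S) where
  range := TightGerm.range
  source := TightGerm.source
  inv := TightGerm.inv
  mul := TightGerm.mul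
  range_mul := TightGerm.range_mul
  source_mul := TightGerm.source_mul
  mul_assoc x y z h h' := TightGerm.mul_assoc' x y z h h' _ _
  range_inv := TightGerm.range_inv
  source_inv := TightGerm.source_inv
  mul_inv x := mul_eq _ (isMul_self_inv x)
  inv_mul x := mul_eq _ (isMul_inv_self x)
  source_range := TightGerm.source_range
  range_source := TightGerm.range_source
  range_mul_self x := mul_eq _ (isMul_range_self x)
  mul_source_self x := mul_eq _ (isMul_source_self x)

end TightGroupoid
open scoped Pointwise

/-- An ultragraph with vertex set `V` and edge set `E` (the direction of edges is such that the
range of an edge is a single vertex and its source is a nonempty set of vertices). -/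
structure Ultragraph (V E : Type*) where
  /-- The unique vertex in the range of an edge. -/
  r : E → V
  /-- The source of an edge. -/
  s : E → Set V
  s_nonempty : ∀ e, (s e).Nonempty

namespace Ultragraph

variable {V E : Type*} (X : Ultragraph V E)

/-- Every vertex receives at most finitely many edges. -/
def RowFinite : Prop := ∀ v : V, {e : E | X.r e = v}.Finite

/-- Every vertex receives at least one edge. -/
def SourceFree : Prop := ∀ v : V, {e : E | X.r e = v}.Nonempty

/-- Membership in the smallest family of sets of vertices that contains `∅`, all singletons and all
sources of edges, and is closed under finite intersections, unions and differences. -/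
inductive IsGen : Set V → Prop
  | empty : IsGen ∅
  | vertex (v : V) : IsGen {v}
  | source (e : E) : IsGen (X.s e)
  | inter {A B : Set V} : IsGen A → IsGen B → IsGen (A ∩ B)
  | union {A B : Set V} : IsGen A → IsGen B → IsGen (A ∪ B)
  | diff {A B : Set V} : IsGen A → IsGen B → IsGen (A \ B)

/-- A list of edges `e₁ ⋯ eₙ` is a path if `r(eᵢ₊₁) ⊆ s(eᵢ)` for all `i`.  The empty list is the
universal path `ω` of length zero; so the lists that are paths form the set `𝓤^♯`, the nonempty
ones form `𝓤^{≥1}`, and concatenation of lists is concatenation of paths. -/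
def IsPath (l : List E) : Prop := l.IsChain (fun e f => X.r f ∈ X.s e)

/-- The source of a path: `s(e₁ ⋯ eₙ) = s(eₙ)`, and `s(ω)` is the set of all vertices. -/
def source (l : List E) : Set V :=
  match l.getLast? with
  | none => Set.univ
  | some e => X.s e

/-- The range of a path: `r(e₁ ⋯ eₙ) = r(e₁)`, and `r(ω)` is the set of all vertices. -/
def range (l : List E) : Set V :=
  match l.head? with
  | none => Set.univ
  | some e => {X.r e}

@[simp] theorem source_nil : X.source [] = Set.univ := rfl

@[simp] theorem source_singleton (e : E) : X.source [e] = X.s e := rfl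

@[simp] theorem range_cons (e : E) (l : List E) : X.range (e :: l) = {X.r e} := rfl

theorem source_append (l m : List E) (hm : m ≠ []) : X.source (l ++ m) = X.source m := by
  simp [source, List.getLast?_append_of_ne_nil l hm]

theorem isPath_append {l m : List E} (hm : m ≠ []) :
    X.IsPath (l ++ m) ↔ X.IsPath l ∧ X.IsPath m ∧ X.range m ⊆ X.source l := by
  obtain ⟨e, m, rfl⟩ := List.exists_cons_of_ne_nil hm
  rw [IsPath, List.isChain_append]
  unfold IsPath
  rcases h : l.getLast? with _ | f <;> simp [source, h]

end Ultragraph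

/-- A self-similar ultragraph `(G, 𝓤, φ)`: the group `G` acts on the ultragraph by automorphisms
(through its actions on vertices and on edges), and `φ` is a 1-cocycle on the edges. -/
structure SelfSimilarUltragraph (G V E : Type*) [Group G] [MulAction G V] [MulAction G E]
    extends Ultragraph V E where
  r_smul : ∀ (g : G) (e : E), r (g • e) = g • r e
  s_smul : ∀ (g : G) (e : E), s (g • e) = g • s e
  φ : G → E → G
  φ_mul : ∀ (g h : G) (e : E), φ (g * h) e = φ g (h • e) * φ h e
  φ_smul_s : ∀ (g : G) (e : E), φ g e • s e ⊆ g • s e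

namespace SelfSimilarUltragraph

variable {G V E : Type*} [Group G] [MulAction G V] [MulAction G E]
variable (X : SelfSimilarUltragraph G V E)

/-- The action on paths, `g · (e₁ e₂ ⋯) = (g · e₁)(φ(g, e₁) · e₂ ⋯)` and `g · ω = ω`. -/
def act (g : G) : List E → List E
  | [] => []
  | e :: l => g • e :: act (X.φ g e) l

/-- The cocycle on paths, `φ(g, e₁ e₂ ⋯) = φ(φ(g, e₁), e₂ ⋯)` and `φ(g, ω) = g`. -/
def coc (g : G) : List E → G
  | [] => g
  | e :: l => coc (X.φ g e) l

@[simp] theorem act_nil (g : G) : X.act g [] = [] := rfl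
@[simp] theorem coc_nil (g : G) : X.coc g [] = g := rfl

theorem φ_one (e : E) : X.φ 1 e = 1 := by
  have h := X.φ_mul 1 1 e
  simpa using h

theorem φ_smul_s_eq (g : G) (e : E) : X.φ g e • X.s e = X.s (g • e) := by
  refine subset_antisymm (by rw [X.s_smul]; exact X.φ_smul_s g e) ?_
  have h := X.φ_smul_s g⁻¹ (g • e)
  have h1 : X.φ g⁻¹ (g • e) = (X.φ g e)⁻¹ := by
    have := X.φ_mul g⁻¹ g e
    rw [inv_mul_cancel, φ_one] at this
    exact eq_inv_of_mul_eq_one_left this.symm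
  rw [h1, X.s_smul, inv_smul_smul] at h
  rw [X.s_smul]
  exact Set.subset_smul_set_iff.2 h

@[simp] theorem act_eq_nil {g : G} {l : List E} : X.act g l = [] ↔ l = [] := by
  cases l <;> simp [act]

theorem act_append (g : G) (l m : List E) :
    X.act g (l ++ m) = X.act g l ++ X.act (X.coc g l) m := by
  induction l generalizing g with
  | nil => rfl
  | cons e l ih => simp [act, coc, ih]

theorem coc_append (g : G) (l m : List E) : X.coc g (l ++ m) = X.coc (X.coc g l) m := by
  induction l generalizing g with
  | nil => rfl
  | cons e l ih => simp [coc, ih]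

theorem act_mul (g h : G) (l : List E) : X.act (g * h) l = X.act g (X.act h l) := by
  induction l generalizing g h with
  | nil => rfl
  | cons e l ih => simp [act, X.φ_mul, ih, mul_smul]

theorem coc_mul (g h : G) (l : List E) :
    X.coc (g * h) l = X.coc g (X.act h l) * X.coc h l := by
  induction l generalizing g h with
  | nil => rfl
  | cons e l ih => simp [act, coc, X.φ_mul, ih]

theorem act_one (l : List E) : X.act 1 l = l := by
  induction l with
  | nil => rfl
  | cons e l ih => simp [act, X.φ_one, ih]

theorem coc_one (l : List E) : X.coc 1 l = 1 := by
  induction l with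
  | nil => rfl
  | cons e l ih => simp [coc, X.φ_one, ih]

@[simp] theorem act_inv_act (g : G) (l : List E) : X.act g⁻¹ (X.act g l) = l := by
  rw [← act_mul, inv_mul_cancel, act_one]

@[simp] theorem act_act_inv (g : G) (l : List E) : X.act g (X.act g⁻¹ l) = l := by
  rw [← act_mul, mul_inv_cancel, act_one]

theorem coc_act_inv (g : G) (l : List E) : X.coc g (X.act g⁻¹ l) = (X.coc g⁻¹ l)⁻¹ := by
  have h := X.coc_mul g g⁻¹ l
  rw [mul_inv_cancel, coc_one] at h
  exact eq_inv_of_mul_eq_one_left h.symm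

theorem source_act (g : G) (l : List E) :
    X.source (X.act g l) = X.coc g l • X.source l := by
  induction l generalizing g with
  | nil => simp
  | cons e l ih =>
    by_cases hl : l = []
    · subst hl
      simp [act, coc, X.φ_smul_s_eq]
    · have h1 : X.source (e :: l) = X.source l := X.source_append [e] l hl
      have h2 : X.source (X.act g (e :: l)) = X.source (X.act (X.φ g e) l) :=
        X.source_append [g • e] _ (by simpa using hl)
      rw [h1, h2, ih]
      rfl

theorem range_act (g : G) {l : List E} (hl : l ≠ []) :
    X.range (X.act g l) = g • X.range l := by
  cases l with
  | nil => exact absurd rfl hl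
  | cons e l => simp [act, X.r_smul]

theorem isPath_act {g : G} {l : List E} (h : X.IsPath l) : X.IsPath (X.act g l) := by
  induction l generalizing g with
  | nil => exact h
  | cons e l ih =>
    by_cases hl : l = []
    · subst hl
      exact List.isChain_singleton _
    · have h1 := (X.isPath_append (l := [e]) hl).1 h
      refine (X.isPath_append (l := [g • e]) (m := X.act (X.φ g e) l) (by simpa using hl)).2
        ⟨List.isChain_singleton _, ih h1.2.1, ?_⟩
      rw [X.range_act _ hl, X.source_singleton, ← X.φ_smul_s_eq]
      exact Set.smul_set_mono h1.2.2

theorem isGen_smul (g : G) {A : Set V} (h : X.IsGen A) : X.IsGen (g • A) := by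
  induction h with
  | empty => rw [Set.smul_set_empty]; exact .empty
  | vertex v => rw [Set.smul_set_singleton]; exact .vertex _
  | source e => rw [← X.s_smul]; exact .source _
  | inter _ _ h1 h2 => rw [Set.smul_set_inter]; exact .inter h1 h2
  | union _ _ h1 h2 => rw [Set.smul_set_union]; exact .union h1 h2
  | diff _ _ h1 h2 => rw [Set.smul_set_sdiff]; exact .diff h1 h2

/-- The nonzero elements `(α, A, g, β)` of the inverse semigroup of a self-similar ultragraph:
`α, β ∈ 𝓤^♯`, `A ∈ 𝓤⁰`, `g ∈ G` and `∅ ≠ A ⊆ s(α) ∩ g · s(β)`. -/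
@[ext] structure Quad where
  α : List E
  A : Set V
  g : G
  β : List E
  α_path : X.IsPath α
  β_path : X.IsPath β
  A_gen : X.IsGen A
  A_nonempty : A.Nonempty
  A_sub : A ⊆ X.source α ∩ g • X.source β

/-- The underlying set of the inverse semigroup `𝓢_{G,𝓤}`: the quadruples and a zero. -/
def InvSemigroup : Type _ := Option X.Quad

variable {X}

namespace Quad

/-- `(α, A, g, β)^* = (β, g⁻¹ · A, g⁻¹, α)`. -/
def adj (p : X.Quad) : X.Quad where
  α := p.β
  A := p.g⁻¹ • p.A
  g := p.g⁻¹
  β := p.α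
  α_path := p.β_path
  β_path := p.α_path
  A_gen := X.isGen_smul _ p.A_gen
  A_nonempty := p.A_nonempty.smul_set
  A_sub := by
    refine Set.subset_inter ?_ (Set.smul_set_mono (p.A_sub.trans Set.inter_subset_left))
    rw [← Set.subset_smul_set_iff]
    exact p.A_sub.trans Set.inter_subset_right

theorem smul_set_of_ext {p q : X.Quad} {ε : List E} (hε : ε ≠ []) (h : q.α = p.β ++ ε) :
    X.source (X.act p.g ε) ∩ X.coc p.g ε • q.A = X.coc p.g ε • q.A := by
  refine Set.inter_eq_right.2 ?_
  rw [X.source_act]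
  refine Set.smul_set_mono (q.A_sub.trans (Set.inter_subset_left.trans ?_))
  rw [h, X.source_append _ _ hε]

theorem set_of_ext' {p q : X.Quad} {ε : List E} (hε : ε ≠ []) (h : p.β = q.α ++ ε) :
    p.A ∩ (p.g * (X.coc q.g⁻¹ ε)⁻¹) • X.source (X.act q.g⁻¹ ε) = p.A := by
  refine Set.inter_eq_left.2 (p.A_sub.trans (Set.inter_subset_right.trans ?_))
  rw [X.source_act, smul_smul, inv_mul_cancel_right, h, X.source_append _ _ hε]

/-- The product `(α, A, g, β)(γ, B, h, δ)` if `γ = βε` with `g · r(ε) ⊆ A`. -/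
def mulExt (p q : X.Quad) (ε : List E)
    (h : ε ≠ [] ∧ q.α = p.β ++ ε ∧ p.g • X.range ε ⊆ p.A) : X.Quad where
  α := p.α ++ X.act p.g ε
  A := X.source (X.act p.g ε) ∩ X.coc p.g ε • q.A
  g := X.coc p.g ε * q.g
  β := q.β
  α_path := by
    have hε := ((X.isPath_append h.1).1 (h.2.1 ▸ q.α_path)).2.1
    refine (X.isPath_append (by simpa using h.1)).2 ⟨p.α_path, X.isPath_act hε, ?_⟩
    rw [X.range_act _ h.1]
    exact h.2.2.trans (p.A_sub.trans Set.inter_subset_left)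
  β_path := q.β_path
  A_gen := by
    rw [smul_set_of_ext h.1 h.2.1]
    exact X.isGen_smul _ q.A_gen
  A_nonempty := by
    rw [smul_set_of_ext h.1 h.2.1]
    exact q.A_nonempty.smul_set
  A_sub := by
    refine Set.subset_inter (Set.inter_subset_left.trans ?_) (Set.inter_subset_right.trans ?_)
    · rw [X.source_append _ _ (by simpa using h.1)]
    · rw [mul_smul]
      exact Set.smul_set_mono (q.A_sub.trans Set.inter_subset_right)

/-- The product `(α, A, g, β)(γ, B, h, δ)` if `β = γε` with `r(ε) ⊆ B`. -/
def mulExt' (p q : X.Quad) (ε : List E)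
    (h : ε ≠ [] ∧ p.β = q.α ++ ε ∧ X.range ε ⊆ q.A) : X.Quad where
  α := p.α
  A := p.A ∩ (p.g * (X.coc q.g⁻¹ ε)⁻¹) • X.source (X.act q.g⁻¹ ε)
  g := p.g * (X.coc q.g⁻¹ ε)⁻¹
  β := q.β ++ X.act q.g⁻¹ ε
  α_path := p.α_path
  β_path := by
    have hε := ((X.isPath_append h.1).1 (h.2.1 ▸ p.β_path)).2.1
    refine (X.isPath_append (by simpa using h.1)).2 ⟨q.β_path, X.isPath_act hε, ?_⟩
    rw [X.range_act _ h.1, ← Set.subset_smul_set_iff]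
    exact h.2.2.trans (q.A_sub.trans Set.inter_subset_right)
  A_gen := by
    rw [set_of_ext' h.1 h.2.1]
    exact p.A_gen
  A_nonempty := by
    rw [set_of_ext' h.1 h.2.1]
    exact p.A_nonempty
  A_sub := by
    refine Set.subset_inter
      (Set.inter_subset_left.trans (p.A_sub.trans Set.inter_subset_left)) ?_
    rw [X.source_append _ _ (by simpa using h.1)]
    exact Set.inter_subset_right

/-- The product `(α, A, g, β)(γ, B, h, δ)` if `γ = β` and `A ∩ g · B ≠ ∅`. -/
def mulEq (p q : X.Quad) (h : q.α = p.β ∧ (p.A ∩ p.g • q.A).Nonempty) : X.Quad where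
  α := p.α
  A := p.A ∩ p.g • q.A
  g := p.g * q.g
  β := q.β
  α_path := p.α_path
  β_path := q.β_path
  A_gen := .inter p.A_gen (X.isGen_smul _ q.A_gen)
  A_nonempty := h.2
  A_sub := by
    refine Set.subset_inter
      (Set.inter_subset_left.trans (p.A_sub.trans Set.inter_subset_left)) ?_
    rw [mul_smul]
    exact Set.inter_subset_right.trans
      (Set.smul_set_mono (q.A_sub.trans Set.inter_subset_right))

open Classical in
/-- The product of two nonzero elements of `𝓢_{G,𝓤}`. -/
noncomputable def mul (p q : X.Quad) : Option X.Quad :=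
  if h : ∃ ε, ε ≠ [] ∧ q.α = p.β ++ ε ∧ p.g • X.range ε ⊆ p.A then
    some (mulExt p q h.choose h.choose_spec)
  else if h : ∃ ε, ε ≠ [] ∧ p.β = q.α ++ ε ∧ X.range ε ⊆ q.A then
    some (mulExt' p q h.choose h.choose_spec)
  else if h : q.α = p.β ∧ (p.A ∩ p.g • q.A).Nonempty then
    some (mulEq p q h)
  else none

end Quad

namespace InvSemigroup

instance : Zero X.InvSemigroup := ⟨(none : Option X.Quad)⟩

/-- The product of `𝓢_{G,𝓤}`, extended by `0 s = s 0 = 0`. -/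
noncomputable instance : Mul X.InvSemigroup :=
  ⟨fun s t => Option.bind s fun p => Option.bind t fun q => p.mul q⟩

instance : Star X.InvSemigroup := ⟨fun s => Option.map Quad.adj s⟩

end InvSemigroup

/-- A nonzero element of `𝓢_{G,𝓤}`. -/
def Quad.elt (p : X.Quad) : X.InvSemigroup := (some p : Option X.Quad)

theorem InvSemigroup.cases (s : X.InvSemigroup) : s = 0 ∨ ∃ p : X.Quad, s = p.elt := by
  rcases s with _ | p
  · exact Or.inl rfl
  · exact Or.inr ⟨p, rfl⟩

theorem InvSemigroup.zero_mul' (s : X.InvSemigroup) : 0 * s = 0 := rfl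

theorem InvSemigroup.mul_zero' (s : X.InvSemigroup) : s * 0 = 0 := by
  rcases s with _ | p <;> rfl

theorem InvSemigroup.star_zero' : star (0 : X.InvSemigroup) = 0 := rfl

theorem Quad.star_elt (p : X.Quad) : star p.elt = p.adj.elt := rfl

theorem Quad.elt_mul_elt (p q : X.Quad) : p.elt * q.elt = p.mul q := rfl

theorem Quad.elt_ne_zero (p : X.Quad) : p.elt ≠ 0 := Option.some_ne_none p

/-- The first vertex of the path `ε` followed by the vertex `v`. -/
def start (X : SelfSimilarUltragraph G V E) (ε : List E) (v : V) : V :=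
  match ε with
  | [] => v
  | e :: _ => X.r e

theorem start_append (l m : List E) (v : V) :
    X.start (l ++ m) v = X.start l (X.start m v) := by
  cases l <;> rfl

theorem start_act (g : G) (l : List E) (v : V) :
    X.start (X.act g l) (X.coc g l • v) = g • X.start l v := by
  cases l <;> simp [start, act, X.r_smul]

theorem smul_range_subset {g : G} {l : List E} (hl : l ≠ []) (A : Set V) (v : V) :
    g • X.range l ⊆ A ↔ g • X.start l v ∈ A := by
  cases l with
  | nil => exact absurd rfl hl
  | cons e l => simp [start]

/-- An auxiliary faithful representation of `𝓢_{G,𝓤}` by partial bijections, used only to verify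
the inverse semigroup laws. -/
def Quad.rel (p : X.Quad) (x y : List E × V × G) : Prop :=
  ∃ ε, x.1 = p.β ++ ε ∧ p.g • X.start ε x.2.1 ∈ p.A ∧
    y = (p.α ++ X.act p.g ε, X.coc p.g ε • x.2.1, X.coc p.g ε * x.2.2)

/-- The representation `Quad.rel` with zero acting as the empty relation. -/
def InvSemigroup.rel (s : X.InvSemigroup) (x y : List E × V × G) : Prop :=
  ∃ p : X.Quad, s = p.elt ∧ p.rel x y

theorem InvSemigroup.rel_elt (p : X.Quad) : InvSemigroup.rel p.elt = p.rel := by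
  funext x y
  refine propext ⟨?_, fun h => ⟨p, rfl, h⟩⟩
  rintro ⟨q, h, hq⟩
  obtain rfl : p = q := Option.some_injective _ h
  exact hq

theorem InvSemigroup.not_rel_zero (x y : List E × V × G) :
    ¬ InvSemigroup.rel (0 : X.InvSemigroup) x y := by
  rintro ⟨q, h, -⟩
  exact q.elt_ne_zero h.symm

theorem Quad.rel_adj (p : X.Quad) (x y : List E × V × G) : p.adj.rel x y ↔ p.rel y x := by
  have key : ∀ (q : X.Quad) (x y : List E × V × G), q.rel x y → q.adj.rel y x := by
    rintro q ⟨l, v, k⟩ _ ⟨ε, rfl, hA, rfl⟩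
    dsimp only at hA
    have hc : X.coc q.g⁻¹ (X.act q.g ε) = (X.coc q.g ε)⁻¹ := by
      have := X.coc_act_inv q.g⁻¹ ε
      rwa [inv_inv] at this
    refine ⟨X.act q.g ε, rfl, ?_, ?_⟩
    · change q.g⁻¹ • _ ∈ q.g⁻¹ • q.A
      rw [X.start_act]
      exact Set.smul_mem_smul_set hA
    · change _ = (q.β ++ X.act q.g⁻¹ _, X.coc q.g⁻¹ _ • _, X.coc q.g⁻¹ _ * _)
      simp [hc]
  refine ⟨fun h => ?_, key p y x⟩
  have h2 := key _ _ _ h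
  have h3 : p.adj.adj = p := by
    ext1 <;> simp [Quad.adj]
  rwa [h3] at h2

theorem InvSemigroup.rel_star (s : X.InvSemigroup) (x y : List E × V × G) :
    InvSemigroup.rel (star s) x y ↔ InvSemigroup.rel s y x := by
  rcases s.cases with rfl | ⟨p, rfl⟩
  · rw [InvSemigroup.star_zero']
    simp [InvSemigroup.not_rel_zero]
  · rw [Quad.star_elt, InvSemigroup.rel_elt, InvSemigroup.rel_elt, Quad.rel_adj]

theorem Quad.rel_right_unique {p : X.Quad} {x y z : List E × V × G} (h1 : p.rel x y)
    (h2 : p.rel x z) : y = z := by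
  obtain ⟨ε, h, -, rfl⟩ := h1
  obtain ⟨ε', h', -, rfl⟩ := h2
  obtain rfl := List.append_cancel_left (h.symm.trans h')
  rfl

theorem InvSemigroup.rel_right_unique {s : X.InvSemigroup} {x y z : List E × V × G}
    (h1 : InvSemigroup.rel s x y) (h2 : InvSemigroup.rel s x z) : y = z := by
  obtain ⟨p, rfl, h1⟩ := h1
  rw [InvSemigroup.rel_elt] at h2
  exact Quad.rel_right_unique h1 h2

theorem InvSemigroup.rel_left_unique {s : X.InvSemigroup} {x y z : List E × V × G}
    (h1 : InvSemigroup.rel s x z) (h2 : InvSemigroup.rel s y z) : x = y :=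
  InvSemigroup.rel_right_unique ((InvSemigroup.rel_star s z x).2 h1)
    ((InvSemigroup.rel_star s z y).2 h2)

theorem Quad.rel_base (p : X.Quad) {v : V} (hv : p.g • v ∈ p.A) :
    p.rel (p.β, v, 1) (p.α, p.g • v, p.g) :=
  ⟨[], by simp, hv, by simp⟩

theorem Quad.rel_injective {p q : X.Quad} (h : p.rel = q.rel) : p = q := by
  have key : ∀ p q : X.Quad, p.rel = q.rel → ∃ ε, p.β = q.β ++ ε := by
    intro p q h
    obtain ⟨a, ha⟩ := p.A_nonempty
    have h1 := p.rel_base (v := p.g⁻¹ • a) (by simpa using ha)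
    rw [h] at h1
    obtain ⟨ε, h2, -⟩ := h1
    exact ⟨ε, h2⟩
  have hβ : p.β = q.β := by
    obtain ⟨ε, h1⟩ := key p q h
    obtain ⟨ε', h2⟩ := key q p h.symm
    have h3 := congrArg List.length h1
    have h4 := congrArg List.length h2
    simp only [List.length_append] at h3 h4
    have : ε = [] := List.length_eq_zero_iff.1 (by omega)
    simpa [this] using h1
  have key2 : ∀ p q : X.Quad, p.rel = q.rel → p.β = q.β → p.α = q.α ∧ p.g = q.g ∧ p.A ⊆ q.A := by
    intro p q h hβ
    have : ∀ a ∈ p.A, p.α = q.α ∧ p.g = q.g ∧ a ∈ q.A := by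
      intro a ha
      have h1 := p.rel_base (v := p.g⁻¹ • a) (by simpa using ha)
      rw [h] at h1
      obtain ⟨ε, h2, h3, h4⟩ := h1
      have hε : ε = [] := by simpa [hβ] using h2
      subst hε
      simp only [Prod.mk.injEq, act_nil, List.append_nil, coc_nil, mul_one] at h4
      obtain ⟨h5, h6, h7⟩ := h4
      refine ⟨h5, h7, ?_⟩
      simpa [start, h7] using h3
    obtain ⟨a, ha⟩ := p.A_nonempty
    exact ⟨(this a ha).1, (this a ha).2.1, fun b hb => (this b hb).2.2⟩
  obtain ⟨h1, h2, h3⟩ := key2 p q h hβ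
  exact Quad.ext h1 (h3.antisymm (key2 q p h.symm hβ.symm).2.2) h2 hβ

theorem InvSemigroup.rel_injective {s t : X.InvSemigroup}
    (h : InvSemigroup.rel s = InvSemigroup.rel t) : s = t := by
  have key : ∀ p : X.Quad, InvSemigroup.rel p.elt ≠ InvSemigroup.rel (0 : X.InvSemigroup) := by
    intro p hp
    obtain ⟨a, ha⟩ := p.A_nonempty
    have h1 := p.rel_base (v := p.g⁻¹ • a) (by simpa using ha)
    rw [← InvSemigroup.rel_elt, hp] at h1
    exact InvSemigroup.not_rel_zero _ _ h1
  rcases s.cases with rfl | ⟨p, rfl⟩ <;> rcases t.cases with rfl | ⟨q, rfl⟩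
  · rfl
  · exact absurd h.symm (key q)
  · exact absurd h (key p)
  · rw [InvSemigroup.rel_elt, InvSemigroup.rel_elt] at h
    rw [Quad.rel_injective h]

theorem Quad.mul_of_ext {p q : X.Quad} {ε : List E}
    (h : ε ≠ [] ∧ q.α = p.β ++ ε ∧ p.g • X.range ε ⊆ p.A) :
    p.mul q = some (mulExt p q ε h) := by
  have h' : ∃ ε, ε ≠ [] ∧ q.α = p.β ++ ε ∧ p.g • X.range ε ⊆ p.A := ⟨ε, h⟩
  have he : h'.choose = ε := List.append_cancel_left (h'.choose_spec.2.1.symm.trans h.2.1)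
  rw [Quad.mul, dif_pos h']
  congr 2

theorem Quad.mul_of_ext' {p q : X.Quad} {ε : List E}
    (h : ε ≠ [] ∧ p.β = q.α ++ ε ∧ X.range ε ⊆ q.A) :
    p.mul q = some (mulExt' p q ε h) := by
  have h' : ∃ ε, ε ≠ [] ∧ p.β = q.α ++ ε ∧ X.range ε ⊆ q.A := ⟨ε, h⟩
  have he : h'.choose = ε := List.append_cancel_left (h'.choose_spec.2.1.symm.trans h.2.1)
  have hn : ¬ ∃ ε, ε ≠ [] ∧ q.α = p.β ++ ε ∧ p.g • X.range ε ⊆ p.A := by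
    rintro ⟨ε', h1, h2, -⟩
    have h3 := congrArg List.length h2
    have h4 := congrArg List.length h.2.1
    have h5 := List.length_pos_of_ne_nil h1
    simp only [List.length_append] at h3 h4
    omega
  rw [Quad.mul, dif_neg hn, dif_pos h']
  congr 2

theorem Quad.mul_of_eq {p q : X.Quad} (h : q.α = p.β ∧ (p.A ∩ p.g • q.A).Nonempty) :
    p.mul q = some (mulEq p q h) := by
  have hn : ¬ ∃ ε, ε ≠ [] ∧ q.α = p.β ++ ε ∧ p.g • X.range ε ⊆ p.A := by
    rintro ⟨ε', h1, h2, -⟩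
    rw [h.1] at h2
    exact h1 (by simpa using h2)
  have hn' : ¬ ∃ ε, ε ≠ [] ∧ p.β = q.α ++ ε ∧ X.range ε ⊆ q.A := by
    rintro ⟨ε', h1, h2, -⟩
    rw [h.1] at h2
    exact h1 (by simpa using h2)
  rw [Quad.mul, dif_neg hn, dif_neg hn', dif_pos h]

theorem Quad.rel_mulExt {p q : X.Quad} {ε : List E}
    (h : ε ≠ [] ∧ q.α = p.β ++ ε ∧ p.g • X.range ε ⊆ p.A) (x z : List E × V × G) :
    (mulExt p q ε h).rel x z ↔ ∃ y, q.rel x y ∧ p.rel y z := by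
  obtain ⟨l, v, k⟩ := x
  have hA : (mulExt p q ε h).A = X.coc p.g ε • q.A := smul_set_of_ext h.1 h.2.1
  constructor
  · rintro ⟨η, rfl, h1, rfl⟩
    dsimp only at h1
    rw [hA] at h1
    change (X.coc p.g ε * q.g) • _ ∈ _ at h1
    rw [mul_smul, Set.smul_mem_smul_set_iff] at h1
    refine ⟨_, ⟨η, rfl, h1, rfl⟩, ε ++ X.act q.g η, ?_, ?_, ?_⟩
    · simp [h.2.1]
    · have h3 := (smul_range_subset h.1 p.A
        (X.start (X.act q.g η) (X.coc q.g η • v))).1 h.2.2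
      rw [start_append]
      exact h3
    · simp [mulExt, act_append, coc_append, act_mul, coc_mul, mul_smul, mul_assoc]
  · rintro ⟨_, ⟨η, rfl, h1, rfl⟩, ε', h2, h3, rfl⟩
    dsimp only at h1 h2 h3
    rw [h.2.1, List.append_assoc] at h2
    obtain rfl := List.append_cancel_left h2
    refine ⟨η, rfl, ?_, ?_⟩
    · rw [hA]
      change (X.coc p.g ε * q.g) • _ ∈ _
      rw [mul_smul]
      exact Set.smul_mem_smul_set h1
    · simp [mulExt, act_append, coc_append, act_mul, coc_mul, mul_smul, mul_assoc]

theorem Quad.rel_mulEq {p q : X.Quad} (h : q.α = p.β ∧ (p.A ∩ p.g • q.A).Nonempty)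
    (x z : List E × V × G) :
    (mulEq p q h).rel x z ↔ ∃ y, q.rel x y ∧ p.rel y z := by
  obtain ⟨l, v, k⟩ := x
  constructor
  · rintro ⟨η, rfl, h1, rfl⟩
    change (p.g * q.g) • _ ∈ p.A ∩ p.g • q.A at h1
    rw [mul_smul] at h1
    have h2 := h1.2
    rw [Set.smul_mem_smul_set_iff] at h2
    refine ⟨_, ⟨η, rfl, h2, rfl⟩, X.act q.g η, ?_, ?_, ?_⟩
    · simp [h.1]
    · dsimp only
      rw [start_act]
      exact h1.1
    · simp [mulEq, act_mul, coc_mul, mul_smul, mul_assoc]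
  · rintro ⟨_, ⟨η, rfl, h1, rfl⟩, ε', h2, h3, rfl⟩
    dsimp only at h1 h2 h3
    rw [h.1] at h2
    obtain rfl := List.append_cancel_left h2
    rw [start_act] at h3
    refine ⟨η, rfl, ?_, ?_⟩
    · change (p.g * q.g) • _ ∈ p.A ∩ p.g • q.A
      rw [mul_smul]
      exact ⟨h3, Set.smul_mem_smul_set h1⟩
    · simp [mulEq, act_mul, coc_mul, mul_smul, mul_assoc]

theorem Quad.mulExt'_eq_adj {p q : X.Quad} {ε : List E}
    (h : ε ≠ [] ∧ p.β = q.α ++ ε ∧ X.range ε ⊆ q.A) :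
    mulExt' p q ε h = (mulExt q.adj p.adj ε
      ⟨h.1, h.2.1, Set.smul_set_mono h.2.2⟩).adj := by
  have hA : (mulExt q.adj p.adj ε ⟨h.1, h.2.1, Set.smul_set_mono h.2.2⟩).A
      = X.coc q.g⁻¹ ε • p.g⁻¹ • p.A := smul_set_of_ext (p := q.adj) (q := p.adj) h.1 h.2.1
  ext1
  · rfl
  · change p.A ∩ _ = (X.coc q.g⁻¹ ε * p.g⁻¹)⁻¹ • (mulExt q.adj p.adj ε _).A
    rw [set_of_ext' h.1 h.2.1, hA]
    simp [smul_smul]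
  · change p.g * (X.coc q.g⁻¹ ε)⁻¹ = (X.coc q.g⁻¹ ε * p.g⁻¹)⁻¹
    simp
  · rfl

theorem Quad.rel_mulExt' {p q : X.Quad} {ε : List E}
    (h : ε ≠ [] ∧ p.β = q.α ++ ε ∧ X.range ε ⊆ q.A) (x z : List E × V × G) :
    (mulExt' p q ε h).rel x z ↔ ∃ y, q.rel x y ∧ p.rel y z := by
  rw [Quad.mulExt'_eq_adj, Quad.rel_adj, Quad.rel_mulExt]
  simp only [Quad.rel_adj, and_comm]

theorem Quad.rel_mul (p q : X.Quad) (x z : List E × V × G) :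
    InvSemigroup.rel (p.elt * q.elt) x z ↔ ∃ y, q.rel x y ∧ p.rel y z := by
  by_cases h1 : ∃ ε, ε ≠ [] ∧ q.α = p.β ++ ε ∧ p.g • X.range ε ⊆ p.A
  · obtain ⟨ε, h1⟩ := h1
    have : p.elt * q.elt = (mulExt p q ε h1).elt := mul_of_ext h1
    rw [this, InvSemigroup.rel_elt, rel_mulExt]
  by_cases h2 : ∃ ε, ε ≠ [] ∧ p.β = q.α ++ ε ∧ X.range ε ⊆ q.A
  · obtain ⟨ε, h2⟩ := h2
    have : p.elt * q.elt = (mulExt' p q ε h2).elt := mul_of_ext' h2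
    rw [this, InvSemigroup.rel_elt, rel_mulExt']
  by_cases h3 : q.α = p.β ∧ (p.A ∩ p.g • q.A).Nonempty
  · have : p.elt * q.elt = (mulEq p q h3).elt := mul_of_eq h3
    rw [this, InvSemigroup.rel_elt, rel_mulEq]
  have h0 : p.elt * q.elt = 0 := by
    rw [elt_mul_elt, Quad.mul, dif_neg h1, dif_neg h2, dif_neg h3]
    rfl
  rw [h0]
  refine iff_of_false (InvSemigroup.not_rel_zero _ _) ?_
  obtain ⟨l, v, k⟩ := x
  rintro ⟨_, ⟨η, rfl, h4, rfl⟩, ε', h5, h6, rfl⟩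
  dsimp only at h4 h5 h6
  rcases List.append_eq_append_iff.1 h5 with ⟨ε, h7, h8⟩ | ⟨ε, h7, h8⟩
  · by_cases hε : ε = []
    · subst hε
      simp only [List.append_nil, List.nil_append] at h7 h8
      subst h8
      rw [start_act] at h6
      exact h3 ⟨h7.symm, _, h6, Set.smul_mem_smul_set h4⟩
    · refine h2 ⟨ε, hε, h7, ?_⟩
      rw [← start_act, h8, start_append] at h4
      have := (smul_range_subset (g := (1 : G)) hε q.A _).2 (by rw [one_smul]; exact h4)
      rwa [one_smul] at this
  · by_cases hε : ε = []
    · subst hε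
      simp only [List.append_nil, List.nil_append] at h7 h8
      subst h8
      rw [start_act] at h6
      exact h3 ⟨h7, _, h6, Set.smul_mem_smul_set h4⟩
    · refine h1 ⟨ε, hε, h7, ?_⟩
      rw [h8, start_append] at h6
      exact (smul_range_subset hε p.A _).2 h6

theorem InvSemigroup.rel_mul (s t : X.InvSemigroup) (x z : List E × V × G) :
    InvSemigroup.rel (s * t) x z ↔ ∃ y, InvSemigroup.rel t x y ∧ InvSemigroup.rel s y z := by
  rcases s.cases with rfl | ⟨p, rfl⟩
  · rw [InvSemigroup.zero_mul']
    simp [InvSemigroup.not_rel_zero]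
  rcases t.cases with rfl | ⟨q, rfl⟩
  · rw [InvSemigroup.mul_zero']
    simp [InvSemigroup.not_rel_zero]
  rw [Quad.rel_mul, InvSemigroup.rel_elt, InvSemigroup.rel_elt]

theorem InvSemigroup.mul_star_mul' (s : X.InvSemigroup) : s * star s * s = s := by
  refine InvSemigroup.rel_injective ?_
  funext x y
  refine propext ?_
  simp only [InvSemigroup.rel_mul, InvSemigroup.rel_star]
  constructor
  · rintro ⟨a, ha, b, hb, hc⟩
    obtain rfl := InvSemigroup.rel_left_unique ha hb
    exact hc
  · exact fun h => ⟨y, h, x, h, h⟩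

/-- `𝓢_{G,𝓤}` is an inverse semigroup with zero. -/
noncomputable instance : InverseSemigroupWithZero X.InvSemigroup where
  mul_assoc s t u := by
    refine InvSemigroup.rel_injective ?_
    funext x y
    refine propext ?_
    simp only [InvSemigroup.rel_mul]
    constructor
    · rintro ⟨a, ha, b, hb, hc⟩
      exact ⟨b, ⟨a, ha, hb⟩, hc⟩
    · rintro ⟨b, ⟨a, ha, hb⟩, hc⟩
      exact ⟨a, ha, b, hb, hc⟩
  zero_mul := InvSemigroup.zero_mul'
  mul_zero := InvSemigroup.mul_zero'
  mul_star_mul := InvSemigroup.mul_star_mul'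
  star_mul_star_self s := by
    have h : star (star s) = s := by
      refine InvSemigroup.rel_injective ?_
      funext x y
      simp only [InvSemigroup.rel_star]
    have h1 := InvSemigroup.mul_star_mul' (star s)
    rwa [h] at h1
  eq_star s t h1 h2 := by
    refine InvSemigroup.rel_injective ?_
    have key : ∀ s t : X.InvSemigroup, s * t * s = s → ∀ x y,
        InvSemigroup.rel s x y → InvSemigroup.rel t y x := by
      intro s t h x y hxy
      have hxy' := hxy
      rw [← h] at hxy'
      simp only [InvSemigroup.rel_mul] at hxy'
      obtain ⟨a, ha, b, hb, hc⟩ := hxy'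
      obtain rfl := InvSemigroup.rel_right_unique hxy ha
      obtain rfl := InvSemigroup.rel_left_unique hxy hc
      exact hb
    funext x y
    refine propext ?_
    rw [InvSemigroup.rel_star]
    exact ⟨key t s h2 x y, key s t h1 y x⟩

/-- The idempotent `q_{(α,A)} = (α, A, 1, α)` for an ultrapath `(α, A)`. -/
def ultrapathIdem (X : SelfSimilarUltragraph G V E) (α : List E) (A : Set V) (hα : X.IsPath α)
    (hA : X.IsGen A) (hne : A.Nonempty) (hsub : A ⊆ X.source α) : X.InvSemigroup :=
  Quad.elt ⟨α, A, 1, α, hα, hα, hA, hne, by simpa using hsub⟩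

/-- `Z(α, A)`, the set of all tight filters containing `q_{(α,A)}`. -/
def Z (X : SelfSimilarUltragraph G V E) (α : List E) (A : Set V) (hα : X.IsPath α)
    (hA : X.IsGen A) (hne : A.Nonempty) (hsub : A ⊆ X.source α) :
    Set (TightSpectrum X.InvSemigroup) :=
  {F | X.ultrapathIdem α A hα hA hne hsub ∈ F.1.1}

/-- `Θ(α, A, g, β) = [(α, A, g, β), Z(β, g⁻¹ · A)]`. -/
def Θ (p : X.Quad) : Set (TightGerm X.InvSemigroup) :=
  TightGerm.bracket p.elt
    (X.Z p.β (p.g⁻¹ • p.A) p.β_path (X.isGen_smul _ p.A_gen) p.A_nonempty.smul_set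
      (Set.subset_smul_set_iff.1 (p.A_sub.trans Set.inter_subset_right)))

end SelfSimilarUltragraph

/-! Most of the statement holds for every inverse semigroup `S` with zero. The sets `{F | e ∈ F}`
are compact open in the Hausdorff tight spectrum: a limit along an ultrafilter is the filter of
eventually contained idempotents, and the tight spectrum is closed among proper filters. A germ `[s,
F]` with `s` fixed is determined by `F`, and also by `θ_s(F)`, while its source depends on `F`
alone. So every `bracket s V` with `V` open is an open bisection, on which source and range are open
embeddings, and `bracket s {F | s^* s ∈ F}` is compact as a continuous image of a compact set.

What may fail for general `S` is that these compact brackets form a basis, since basic open sets of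
the spectrum also impose conditions `f ∉ F`. They do form one if every idempotent outside a tight
filter is orthogonal to a member of it: then `f ∉ F` follows, near the given filter, from a
membership `k ∈ F` with `k * f = 0`. Intersecting finitely many memberships leaves a single `e ∈ F`,
and this is absorbed by replacing `s` with `s * e` (`TightSpectrum.exists_mem_subset_of_isOpen`,
`isTopologicalBasis_compact_brackets`).

For a self-similar ultragraph this orthogonality is `exists_mem_mul_eq_zero`. Nonzero idempotents
are pairs `(α, A)`, viewed as sets of paths beginning with `α` and continuing from a vertex of `A`.
Tight filters respect finite covers, and two kinds of cover suffice: `(α, A)` is covered by `(α, B)`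
and `(α, A \ B)`, and `(α, {v})` is covered by the `(αe, s(e))` with `r(e) = v`, of which there are
finitely many and at least one. Following a path edge by edge, a filter either reaches `(β, B)` or
contains something orthogonal to it. Finally `Z(β, g⁻¹ · A)` is the set of tight filters containing
`s^* s` for `s = (α, A, g, β)`, so the sets `Θ` are exactly the compact brackets of nonzero
elements. -/

section TightGroupoid

/-! ### Tight filters, and the topology of the tight spectrum. -/

variable {S : Type*} [InverseSemigroupWithZero S]

open InverseSemigroupWithZero

/-- An idempotent that does not belong to an ultrafilter is orthogonal to one of its members. -/
theorem exists_mem_mul_eq_zero_of_ultra {F : ProperFilter S} (hF : F ∈ ultraFilters S) {f : S}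
    (hf : IsIdempotentElem f) (hfF : f ∉ F.1) : ∃ e ∈ F.1, e * f = 0 := by
  by_contra! hne
  have hid := F.2.1.idem
  -- The filter generated by `F` and `f`. It is proper because no `e * f` vanishes, so maximality of
  -- `F` forces `f ∈ F`.
  let H : Set S := {t | IsIdempotentElem t ∧ ∃ e ∈ F.1, t * (e * f) = e * f}
  have hH : IsIdemFilter H := by
    refine ⟨fun e he => he.1, ?_, ?_, ?_⟩
    · obtain ⟨e, he⟩ := F.2.1.nonempty
      exact ⟨e, hid e he, e, he, by rw [← mul_assoc, (hid e he).eq]⟩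
    · rintro a ⟨ha, e, he, h1⟩ b ⟨hb, e', he', h2⟩
      refine ⟨idem_mul ha hb, e * e', F.2.1.mul_mem _ he _ he', ?_⟩
      have hee := hid e he
      have hee' := hid e' he'
      have k1 : b * (e * e' * f) = e * e' * f := by
        calc b * (e * e' * f) = (b * e) * (e' * f) := by simp only [mul_assoc]
          _ = e * (b * (e' * f)) := by rw [idem_comm hb hee, mul_assoc]
          _ = e * e' * f := by rw [h2, mul_assoc]
      have k2 : a * (e * e' * f) = e * e' * f := by
        calc a * (e * e' * f) = (a * e') * (e * f) := by
              rw [idem_comm hee hee']; simp only [mul_assoc]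
          _ = e' * (a * (e * f)) := by rw [idem_comm ha hee', mul_assoc]
          _ = e * e' * f := by rw [h1, ← mul_assoc, idem_comm hee hee']
      rw [mul_assoc, k1, k2]
    · rintro a ⟨ha, e, he, h1⟩ b hb ⟨k, hk, rfl⟩
      refine ⟨hb, e, he, ?_⟩
      rw [← h1, mul_assoc b, ← mul_assoc b, hb.eq]
  have h0 : (0 : S) ∉ H := by
    rintro ⟨-, e, he, h⟩
    exact hne e he (by rw [← h, zero_mul])
  have hle : F.1 ⊆ H := fun e he => ⟨hid e he, e, he, by rw [← mul_assoc, (hid e he).eq]⟩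
  have h1 := hF ⟨H, hH, h0⟩ hle
  obtain ⟨e, he⟩ := F.2.1.nonempty
  refine hfF ?_
  rw [← h1]
  exact ⟨hf, e, he, by rw [idem_comm (hid e he) hf, ← mul_assoc, hf.eq]⟩

/-- Tight filters meet finite covers: if no element of a finite set `Y` of idempotents belongs to a
tight filter `F`, then every element of `F` dominates a nonzero idempotent orthogonal to `Y`. -/
theorem TightSpectrum.exists_orthogonal (F : TightSpectrum S) {e : S} (he : e ∈ F.1.1)
    (Y : Finset S) (hY : ∀ f ∈ Y, IsIdempotentElem f) (hYF : ∀ f ∈ Y, f ∉ F.1.1) :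
    ∃ k : S, IsIdempotentElem k ∧ k ≠ 0 ∧ e * k = k ∧ ∀ f ∈ Y, k * f = 0 := by
  classical
  -- The conditions on `F` define an open set, which therefore contains an ultrafilter `K`. In `K`,
  -- members orthogonal to the individual `f ∈ Y` exist, and their product with `e` is nonzero.
  obtain ⟨K, ⟨heK, hYK⟩, hK⟩ := mem_closure_iff.1 F.2 _
    (ProperFilter.isOpen_basic (F.1.2.1.idem e he) hY) ⟨he, hYF⟩
  have key : ∀ Z : Finset S, Z ⊆ Y → ∃ k ∈ K.1, e * k = k ∧ ∀ f ∈ Z, k * f = 0 := by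
    intro Z
    induction Z using Finset.induction_on with
    | empty => exact fun _ => ⟨e, heK, (K.2.1.idem e heK).eq, by simp⟩
    | insert f Z _ ih =>
      intro hZ
      obtain ⟨k, hkK, hek, hk⟩ := ih ((Finset.subset_insert _ _).trans hZ)
      have hfY := hZ (Finset.mem_insert_self f Z)
      obtain ⟨k', hkK', hk'⟩ := exists_mem_mul_eq_zero_of_ultra hK (hY f hfY) (hYK f hfY)
      refine ⟨k * k', K.2.1.mul_mem _ hkK _ hkK', by rw [← mul_assoc, hek], ?_⟩
      intro f' hf'
      rcases Finset.mem_insert.1 hf' with rfl | hf'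
      · rw [mul_assoc, hk', mul_zero]
      · rw [idem_comm (K.2.1.idem _ hkK) (K.2.1.idem _ hkK'), mul_assoc, hk f' hf', mul_zero]
  obtain ⟨k, hkK, hek, hk⟩ := key Y subset_rfl
  exact ⟨k, K.2.1.idem k hkK, fun h => K.2.2 (h ▸ hkK), hek, hk⟩

/-- Every ultrafilter `𝒰` on this set converges to the filter of those `t` that lie in `𝒰`-almost
every `F`. Requiring `e ∈ F` is what keeps this limit nonempty. -/
theorem ProperFilter.isCompact_mem (e : S) :
    IsCompact {F : ProperFilter S | e ∈ F.1} := by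
  refine isCompact_iff_ultrafilter_le_nhds.2 fun 𝒰 h𝒰 => ?_
  have h𝒰' : ∀ᶠ F : ProperFilter S in 𝒰, e ∈ F.1 := Filter.le_principal_iff.1 h𝒰
  let H : Set S := {t | ∀ᶠ F : ProperFilter S in 𝒰, t ∈ F.1}
  have hH : IsIdemFilter H := by
    refine ⟨?_, ⟨e, h𝒰'⟩, ?_, ?_⟩
    · intro t (ht : ∀ᶠ F : ProperFilter S in 𝒰, t ∈ F.1)
      obtain ⟨F, hF⟩ := ht.exists
      exact F.2.1.idem t hF
    · intro a (ha : ∀ᶠ F : ProperFilter S in 𝒰, a ∈ F.1) b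
        (hb : ∀ᶠ F : ProperFilter S in 𝒰, b ∈ F.1)
      exact (ha.and hb).mono fun F hF => F.2.1.mul_mem _ hF.1 _ hF.2
    · intro a (ha : ∀ᶠ F : ProperFilter S in 𝒰, a ∈ F.1) b hb hab
      exact ha.mono fun F hF => F.2.1.up a hF b hb hab
  have h0 : (0 : S) ∉ H := by
    intro (h : ∀ᶠ F : ProperFilter S in 𝒰, (0 : S) ∈ F.1)
    obtain ⟨F, hF⟩ := h.exists
    exact F.2.2 hF
  refine ⟨⟨H, hH, h0⟩, h𝒰', ?_⟩
  -- Convergence need only be tested on the generating sets. The negative conditions pass to `𝒰`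
  -- because an ultrafilter decides every property, and there are finitely many of them.
  refine le_of_le_of_eq (le_iInf₂ fun U hU => Filter.le_principal_iff.2 ?_)
    TopologicalSpace.nhds_generateFrom.symm
  obtain ⟨h1, a, Y, ha, hY, rfl⟩ := hU
  have h2 : ∀ᶠ F : ProperFilter S in 𝒰, a ∈ F.1 := h1.1
  have h3 : ∀ᶠ F : ProperFilter S in 𝒰, ∀ f ∈ Y, f ∉ F.1 :=
    (Filter.eventually_all_finset Y).2 fun f hf => Ultrafilter.eventually_not.2 (h1.2 f hf)
  exact h2.and h3

namespace TightSpectrum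

theorem continuous_val : Continuous (fun F : TightSpectrum S => F.1) := continuous_subtype_val

theorem isOpen_mem {e : S} (he : IsIdempotentElem e) :
    IsOpen {F : TightSpectrum S | e ∈ F.1.1} :=
  (ProperFilter.isOpen_mem he).preimage continuous_val

theorem isCompact_mem (e : S) :
    IsCompact {F : TightSpectrum S | e ∈ F.1.1} := by
  have h : Topology.IsClosedEmbedding (fun F : TightSpectrum S => F.1) :=
    isClosed_closure.isClosedEmbedding_subtypeVal
  exact h.isCompact_preimage (ProperFilter.isCompact_mem e)

instance : T2Space (TightSpectrum S) := by
  have key : ∀ (F H : TightSpectrum S) (e : S), e ∈ F.1.1 → e ∉ H.1.1 →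
      ∃ u v : Set (TightSpectrum S), IsOpen u ∧ IsOpen v ∧ F ∈ u ∧ H ∈ v ∧ Disjoint u v := by
    intro F H e he he'
    have hei := F.1.2.1.idem e he
    -- A generating open set needs a positive condition; any member `k` of `H` serves beside the
    -- exclusion of `e`.
    obtain ⟨k, hk⟩ := H.1.2.1.nonempty
    refine ⟨_, {K | k ∈ K.1.1 ∧ ∀ f ∈ ({e} : Finset S), f ∉ K.1.1}, isOpen_mem hei,
      (ProperFilter.isOpen_basic (Y := {e}) (H.1.2.1.idem k hk) ?_).preimage continuous_val,
      he, ⟨hk, by simpa using he'⟩, ?_⟩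
    · simpa using hei
    · exact Set.disjoint_left.2 fun K h1 h2 => h2.2 e (Finset.mem_singleton_self e) h1
  refine ⟨fun F H hne => ?_⟩
  have : ∃ e, ¬ (e ∈ F.1.1 ↔ e ∈ H.1.1) := by
    by_contra! h
    exact hne (ext_idem fun t _ => h t)
  obtain ⟨e, he⟩ := this
  by_cases h1 : e ∈ F.1.1
  · exact key F H e h1 fun h2 => he ⟨fun _ => h2, fun _ => h1⟩
  · have h2 : e ∈ H.1.1 := by tauto
    obtain ⟨u, v, hu, hv, hF, hH, huv⟩ := key H F e h2 h1
    exact ⟨v, u, hv, hu, hH, hF, huv.symm⟩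

theorem isOpen_θ_mem (s : S) {V : Set (TightSpectrum S)} (hV : IsOpen V) :
    IsOpen {F : TightSpectrum S | ∃ hs : star s * s ∈ F.1.1, θ s F hs ∈ V} := by
  have hc : Continuous (fun F : {F : TightSpectrum S // star s * s ∈ F.1.1} => θ s F.1 F.2) := by
    refine Continuous.subtype_mk ?_ _
    exact (ProperFilter.continuous_conj s).comp
      (Continuous.subtype_mk (continuous_val.comp continuous_subtype_val) fun F => F.2)
  -- `θ s` is continuous only on its open domain, so the preimage is formed there and then pushed
  -- into the whole spectrum.
  have h := (isOpen_mem (star_mul_self_idem s)).isOpenMap_subtype_val _ (hV.preimage hc)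
  convert h using 1
  ext F
  constructor
  · rintro ⟨hs, hF⟩
    exact ⟨⟨F, hs⟩, hF, rfl⟩
  · rintro ⟨⟨F, hs⟩, hF, rfl⟩
    exact ⟨hs, hF⟩

/-- `F` is recovered from `θ_s(F)`: membership of `t` in `F` is membership of `s * t * star s` in
`θ_s(F)`. -/
theorem θ_injective {s : S} {F H : TightSpectrum S} {hs : star s * s ∈ F.1.1}
    {ht : star s * s ∈ H.1.1} (h : θ s F hs = θ s H ht) : F = H := by
  refine ext_idem fun t ht' => ?_
  have key : ∀ (K : TightSpectrum S) (hK : star s * s ∈ K.1.1),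
      t ∈ K.1.1 ↔ s * t * star s ∈ (θ s K hK).1.1 := by
    intro K hK
    have h1 := star_mul_self_idem s
    rw [mem_θ hK (conj_idem s ht')]
    have h2 : star s * (s * t * star s) * s = (star s * s) * (t * (star s * s)) := by
      simp only [mul_assoc]
    rw [h2, K.mul_mem_iff h1 (idem_mul ht' h1), K.mul_mem_iff ht' h1]
    tauto
  rw [key F hs, key H ht, h]

end TightSpectrum

/-! ### The germ topology and continuity of the groupoid operations. -/

namespace TightGerm

open TightSpectrum

theorem mk_mem_bracket {s t : S} {F : TightSpectrum S} {hs : star s * s ∈ F.1.1}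
    {V : Set (TightSpectrum S)} :
    mk s F hs ∈ bracket t V ↔ F ∈ V ∧ star t * t ∈ F.1.1 ∧ ∃ e ∈ F.1.1, s * e = t * e := by
  constructor
  · rintro ⟨H, hH, ht, h⟩
    obtain ⟨rfl, h1⟩ := mk_eq_mk.1 h
    exact ⟨hH, ht, h1⟩
  · rintro ⟨hF, ht, h⟩
    exact ⟨F, hF, ht, mk_eq_mk.2 ⟨rfl, h⟩⟩

theorem isOpen_bracket (s : S) {V : Set (TightSpectrum S)} (hV : IsOpen V) :
    IsOpen (bracket s V) := TopologicalSpace.isOpen_generateFrom_of_mem ⟨s, V, hV, rfl⟩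

/-- If `s` and `t` have the same germ at `F`, witnessed by `e ∈ F`, the same `e` witnesses it at
every `H` containing `e`, `s^* s` and `t^* t`. This is an open condition on `H`, so intersections of
brackets contain brackets. -/
theorem isTopologicalBasis_bracket : TopologicalSpace.IsTopologicalBasis
    {U : Set (TightGerm S) | ∃ (s : S) (V : Set (TightSpectrum S)), IsOpen V ∧ U = bracket s V} := by
  refine ⟨?_, ?_, rfl⟩
  · rintro _ ⟨s, V, hV, rfl⟩ _ ⟨t, W, hW, rfl⟩ x ⟨h1, h2⟩
    obtain ⟨F, hF, hs, rfl⟩ := h1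
    obtain ⟨hF', ht, e, he, h⟩ := mk_mem_bracket.1 h2
    have hei := F.1.2.1.idem e he
    refine ⟨_, ⟨s, V ∩ W ∩ {H | star t * t ∈ H.1.1} ∩ {H | e ∈ H.1.1},
      (((hV.inter hW).inter (isOpen_mem (star_mul_self_idem t))).inter (isOpen_mem hei)), rfl⟩,
      ⟨F, ⟨⟨⟨hF, hF'⟩, ht⟩, he⟩, hs, rfl⟩, ?_⟩
    rintro _ ⟨H, ⟨⟨⟨h3, h4⟩, h5⟩, h6⟩, hs', rfl⟩
    exact ⟨⟨H, h3, hs', rfl⟩, mk_mem_bracket.2 ⟨h4, h5, e, h6, h⟩⟩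
  · refine Set.eq_univ_of_forall fun x => ?_
    induction x using ind with
    | h s F hs => exact ⟨_, ⟨s, Set.univ, isOpen_univ, rfl⟩, F, trivial, hs, rfl⟩

/-- The filter at which a germ is taken. -/
def dom (x : TightGerm S) : TightSpectrum S :=
  Quotient.lift (fun p : PreGerm S => p.1.2) (fun _ _ h => And.left h) x

@[simp] theorem dom_mk (s : S) (F : TightSpectrum S) (hs : star s * s ∈ F.1.1) :
    dom (mk s F hs) = F := rfl

theorem continuous_dom : Continuous (dom : TightGerm S → TightSpectrum S) := by
  refine ⟨fun V hV => ?_⟩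
  have : dom ⁻¹' V = ⋃ s : S, bracket s V := by
    ext x
    rw [Set.mem_iUnion]
    constructor
    · induction x using ind with
      | h s F hs => exact fun hF => ⟨s, F, hF, hs, rfl⟩
    · rintro ⟨s, F, hF, hs, rfl⟩
      exact hF
  rw [this]
  exact isOpen_iUnion fun s => isOpen_bracket s hV

/-- All idempotents in `F` have the same germ at `F`, so a unit carries no information beyond its
filter. -/
theorem source_eq_source {x y : TightGerm S} : source x = source y ↔ dom x = dom y := by
  induction x using ind with
  | h s F hs =>
    induction y using ind with
    | h t H ht =>
      refine ⟨fun h => (mk_eq_mk.1 h).1, ?_⟩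
      rintro (rfl : F = H)
      exact mk_idem_eq (star_mul_self_idem _) (star_mul_self_idem _)

theorem dom_source (x : TightGerm S) : dom (source x) = dom x := by
  rw [← source_eq_source, source_source]

theorem continuous_source : Continuous (source : TightGerm S → TightGerm S) := by
  refine continuous_generateFrom_iff.2 ?_
  rintro _ ⟨t, V, hV, rfl⟩
  refine isOpen_iff_forall_mem_open.2 fun x hx => ?_
  induction x using ind with
  | h s F hs =>
    obtain ⟨hF, ht, e, he, h⟩ := mk_mem_bracket.1 hx
    have hei := F.1.2.1.idem e he
    have hss := star_mul_self_idem s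
    refine ⟨dom ⁻¹' (V ∩ {H | star t * t ∈ H.1.1} ∩ {H | e ∈ H.1.1} ∩ {H | star s * s ∈ H.1.1}),
      ?_, (((hV.inter (isOpen_mem (star_mul_self_idem t))).inter
        (isOpen_mem hei)).inter (isOpen_mem hss)).preimage continuous_dom, ⟨⟨hF, ht⟩, he⟩, hs⟩
    intro y hy
    induction y using ind with
    | h u H hu =>
      obtain ⟨⟨⟨h1, h2⟩, h3⟩, h4⟩ := hy
      -- The nearby germ comes from an arbitrary `u`, but the unit at `H` may be rewritten with
      -- `star s * s`, for which the witness `e` is available.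
      have h5 : mk (star u * u) H (idem_mem (star_mul_self_idem _) hu) =
          mk (star s * s) H (idem_mem (star_mul_self_idem _) h4) :=
        mk_idem_eq (star_mul_self_idem _) (star_mul_self_idem _)
      change mk (star u * u) H _ ∈ bracket t V
      rw [h5]
      exact mk_mem_bracket.2 ⟨h1, h2, e, h3, h⟩

theorem continuous_inv : Continuous (inv : TightGerm S → TightGerm S) := by
  refine continuous_generateFrom_iff.2 ?_
  rintro _ ⟨t, V, hV, rfl⟩
  refine isOpen_iff_forall_mem_open.2 fun x hx => ?_
  induction x using ind with
  | h s F hs =>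
    obtain ⟨hF, ht, e, he, h⟩ := mk_mem_bracket.1 hx
    have hei := (θ s F hs).1.2.1.idem e he
    -- The condition on the inverse germ is one on `θ s H`, hence is pulled back along `θ s`.
    refine ⟨bracket s {H | ∃ hs' : star s * s ∈ H.1.1,
        θ s H hs' ∈ V ∩ {H | star t * t ∈ H.1.1} ∩ {H | e ∈ H.1.1}}, ?_,
      isOpen_bracket s (isOpen_θ_mem s ((hV.inter (isOpen_mem (star_mul_self_idem t))).inter
        (isOpen_mem hei))), F, ⟨hs, ⟨hF, ht⟩, he⟩, hs, rfl⟩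
    rintro _ ⟨H, ⟨hs', ⟨h1, h2⟩, h3⟩, -, rfl⟩
    exact mk_mem_bracket.2 ⟨h1, h2, e, h3, h⟩

theorem inv_inv' (x : TightGerm S) : inv (inv x) = x := by
  induction x using ind with
  | h s F hs => exact mk_congr (star_star' s) (θ_star_θ hs)

theorem continuous_range : Continuous (range : TightGerm S → TightGerm S) := by
  have h := continuous_source.comp (continuous_inv (S := S))
  convert h using 1
  funext x
  exact (source_inv x).symm

theorem continuous_mul : Continuous
    (fun p : {p : TightGerm S × TightGerm S // source p.1 = range p.2} =>
      mul p.1.1 p.1.2 p.2) := by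
  refine continuous_generateFrom_iff.2 ?_
  rintro _ ⟨u, V, hV, rfl⟩
  refine isOpen_iff_forall_mem_open.2 fun p hp => ?_
  obtain ⟨⟨x, y⟩, hxy⟩ := p
  obtain ⟨t, s, F, hs, ht, rfl, rfl⟩ := exists_rep hxy
  change mul _ _ hxy ∈ bracket u V at hp
  rw [mul_mk] at hp
  obtain ⟨hF, hu, e, he, h⟩ := mk_mem_bracket.1 hp
  have hei := F.1.2.1.idem e he
  -- The left factor needs no restriction on its filter: composability forces that filter to be `θ s
  -- H`.
  refine ⟨Subtype.val ⁻¹' (bracket t Set.univ ×ˢ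
      bracket s (V ∩ {H | star u * u ∈ H.1.1} ∩ {H | e ∈ H.1.1})), ?_,
    ((isOpen_bracket t isOpen_univ).prod (isOpen_bracket s
      ((hV.inter (isOpen_mem (star_mul_self_idem u))).inter
        (isOpen_mem hei)))).preimage continuous_subtype_val,
    ⟨_, trivial, ht, rfl⟩, F, ⟨⟨hF, hu⟩, he⟩, hs, rfl⟩
  rintro ⟨⟨x, y⟩, hxy'⟩ ⟨⟨K, -, hK, (h1 : x = _)⟩, ⟨H, ⟨⟨h3, h4⟩, h5⟩, hH, (h2 : y = _)⟩⟩
  subst h1 h2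
  obtain rfl : K = θ s H hH := source_eq_range.1 hxy'
  change mul _ _ hxy' ∈ bracket u V
  rw [mul_mk]
  exact mk_mem_bracket.2 ⟨h3, h4, e, h5, h⟩

/-- It is the image of the compact set `{F | s^* s ∈ F}` under the continuous map `F ↦ [s, F]`. -/
theorem isCompact_bracket (s : S) :
    IsCompact (bracket s {F : TightSpectrum S | star s * s ∈ F.1.1}) := by
  have hc : Continuous (fun F : {F : TightSpectrum S // star s * s ∈ F.1.1} => mk s F.1 F.2) := by
    refine continuous_generateFrom_iff.2 ?_
    rintro _ ⟨t, V, hV, rfl⟩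
    refine isOpen_iff_forall_mem_open.2 fun F hF => ?_
    obtain ⟨hF, ht, e, he, h⟩ := mk_mem_bracket.1 hF
    have hei := F.1.1.2.1.idem e he
    refine ⟨Subtype.val ⁻¹' (V ∩ {H | star t * t ∈ H.1.1} ∩ {H | e ∈ H.1.1}), ?_,
      ((hV.inter (isOpen_mem (star_mul_self_idem t))).inter (isOpen_mem hei)).preimage
        continuous_subtype_val, ⟨hF, ht⟩, he⟩
    rintro H ⟨⟨h1, h2⟩, h3⟩
    exact mk_mem_bracket.2 ⟨h1, h2, e, h3, h⟩
  have hK := isCompact_iff_isCompact_univ.1 (isCompact_mem (star s * s))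
  convert hK.image hc using 1
  ext x
  constructor
  · rintro ⟨F, hF, hs, rfl⟩
    exact ⟨⟨F, hF⟩, trivial, rfl⟩
  · rintro ⟨F, -, rfl⟩
    exact ⟨F.1, F.2, F.2, rfl⟩

end TightGerm

/-! ### Étale structure and open bisections of the tight groupoid. -/

section

open TightGerm TightSpectrum

theorem tightGroupoid_isTopological : (tightGroupoid S).IsTopological where
  continuous_mul := continuous_mul
  continuous_inv := continuous_inv
  continuous_range := continuous_range
  continuous_source := continuous_source

theorem tightGroupoid_exists_source_eq (u : (tightGroupoid S).units) :
    ∃ x, (tightGroupoid S).sourceMap x = u := by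
  obtain ⟨u, x, rfl⟩ := u
  exact ⟨x, Subtype.ext ((tightGroupoid S).inv_mul x).symm⟩

theorem tightGroupoid_sourceMap_eq {x y : TightGerm S} :
    (tightGroupoid S).sourceMap x = (tightGroupoid S).sourceMap y ↔ dom x = dom y := by
  rw [← source_eq_source]
  exact Subtype.ext_iff

/-- On units `dom` is a continuous injection into the Hausdorff tight spectrum. On arbitrary germs
it need not be injective, so the argument does not extend to the whole groupoid. -/
theorem t2Space_tightGroupoid_units : T2Space (tightGroupoid S).units := by
  refine T2Space.of_injective_continuous (f := fun u : (tightGroupoid S).units => dom u.1) ?_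
    (continuous_dom.comp continuous_subtype_val)
  intro u v huv
  obtain ⟨x, rfl⟩ := tightGroupoid_exists_source_eq u
  obtain ⟨y, rfl⟩ := tightGroupoid_exists_source_eq v
  change dom (source x) = dom (source y) at huv
  rw [dom_source, dom_source] at huv
  exact tightGroupoid_sourceMap_eq.2 huv

theorem continuous_tightGroupoid_sourceMap : Continuous (tightGroupoid S).sourceMap :=
  Continuous.subtype_mk continuous_source _

theorem isOpenMap_tightGroupoid_sourceMap : IsOpenMap (tightGroupoid S).sourceMap := by
  refine isTopologicalBasis_bracket.isOpenMap_iff.2 ?_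
  rintro _ ⟨s, V, hV, rfl⟩
  -- The image consists of all units whose filter lies in an open set, hence is a preimage under
  -- `dom`.
  have : (tightGroupoid S).sourceMap '' bracket s V =
      (fun u : (tightGroupoid S).units => dom u.1) ⁻¹' (V ∩ {F | star s * s ∈ F.1.1}) := by
    ext u
    obtain ⟨x, rfl⟩ := tightGroupoid_exists_source_eq u
    constructor
    · rintro ⟨y, ⟨F, hF, hs, rfl⟩, h⟩
      rw [← h]
      exact ⟨hF, hs⟩
    · intro h
      have h1 : dom (source x) ∈ V ∩ {F | star s * s ∈ F.1.1} := h
      rw [dom_source] at h1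
      exact ⟨mk s (dom x) h1.2, ⟨_, h1.1, h1.2, rfl⟩, tightGroupoid_sourceMap_eq.2 rfl⟩
  rw [this]
  exact (hV.inter (isOpen_mem (star_mul_self_idem s))).preimage
    (continuous_dom.comp continuous_subtype_val)

/-- Transfers openness, and part of the injectivity argument, from the source to the range, since
inversion is a homeomorphism. -/
theorem tightGroupoid_rangeMap_eq :
    (tightGroupoid S).rangeMap = (tightGroupoid S).sourceMap ∘ TightGerm.inv :=
  funext fun x => Subtype.ext (source_inv x).symm

theorem continuous_tightGroupoid_rangeMap : Continuous (tightGroupoid S).rangeMap :=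
  Continuous.subtype_mk continuous_range _

theorem isOpenMap_tightGroupoid_rangeMap : IsOpenMap (tightGroupoid S).rangeMap := by
  rw [tightGroupoid_rangeMap_eq]
  refine isOpenMap_tightGroupoid_sourceMap.comp fun U hU => ?_
  have : TightGerm.inv '' U = TightGerm.inv ⁻¹' U :=
    congrFun (Set.image_eq_preimage_of_inverse (f := TightGerm.inv) inv_inv' inv_inv') U
  rw [this]
  exact hU.preimage TightGerm.continuous_inv

theorem isOpenEmbedding_sourceMap_bracket (s : S) {V : Set (TightSpectrum S)} (hV : IsOpen V) :
    Topology.IsOpenEmbedding ((bracket s V).domRestrict (tightGroupoid S).sourceMap) := by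
  refine .of_continuous_injective_isOpenMap
    (continuous_tightGroupoid_sourceMap.comp continuous_subtype_val) ?_
    (isOpenMap_tightGroupoid_sourceMap.comp (isOpen_bracket s hV).isOpenMap_subtype_val)
  rintro ⟨x, F, _, hs, rfl⟩ ⟨y, H, _, ht, rfl⟩ h
  exact Subtype.ext (mk_congr rfl (tightGroupoid_sourceMap_eq.1 h))

theorem isOpenEmbedding_rangeMap_bracket (s : S) {V : Set (TightSpectrum S)} (hV : IsOpen V) :
    Topology.IsOpenEmbedding ((bracket s V).domRestrict (tightGroupoid S).rangeMap) := by
  refine .of_continuous_injective_isOpenMap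
    (continuous_tightGroupoid_rangeMap.comp continuous_subtype_val) ?_
    (isOpenMap_tightGroupoid_rangeMap.comp (isOpen_bracket s hV).isOpenMap_subtype_val)
  rintro ⟨x, F, _, hs, rfl⟩ ⟨y, H, _, ht, rfl⟩ h
  have h1 : (tightGroupoid S).rangeMap (mk s F hs) = (tightGroupoid S).rangeMap (mk s H ht) := h
  rw [tightGroupoid_rangeMap_eq] at h1
  -- Equal ranges give `θ s F = θ s H`, and injectivity of `θ s` gives `F = H`; both germs are taken
  -- with the same `s`.
  exact Subtype.ext (mk_congr rfl (θ_injective (tightGroupoid_sourceMap_eq.1 h1)))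

theorem isBisection_bracket (s : S) {V : Set (TightSpectrum S)} (hV : IsOpen V) :
    (tightGroupoid S).IsBisection (bracket s V) :=
  ⟨(isOpenEmbedding_rangeMap_bracket s hV).isEmbedding,
    (isOpenEmbedding_sourceMap_bracket s hV).isEmbedding⟩

theorem exists_isOpen_bracket_mem_nhds (x : TightGerm S) :
    ∃ s : S, bracket s (Set.univ : Set (TightSpectrum S)) ∈ nhds x := by
  induction x using TightGerm.ind with
  | h s F hs => exact ⟨s, (isOpen_bracket s isOpen_univ).mem_nhds ⟨F, trivial, hs, rfl⟩⟩

theorem isLocalHomeomorph_tightGroupoid_sourceMap :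
    IsLocalHomeomorph (tightGroupoid S).sourceMap := by
  refine isLocalHomeomorph_iff_isOpenEmbedding_restrict.2 fun x => ?_
  obtain ⟨s, hs⟩ := exists_isOpen_bracket_mem_nhds x
  exact ⟨_, hs, isOpenEmbedding_sourceMap_bracket s isOpen_univ⟩

theorem isLocalHomeomorph_tightGroupoid_rangeMap :
    IsLocalHomeomorph (tightGroupoid S).rangeMap := by
  refine isLocalHomeomorph_iff_isOpenEmbedding_restrict.2 fun x => ?_
  obtain ⟨s, hs⟩ := exists_isOpen_bracket_mem_nhds x
  exact ⟨_, hs, isOpenEmbedding_rangeMap_bracket s isOpen_univ⟩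

/-! ### From open sets with exclusions to compact brackets. -/

/-- If every idempotent outside a tight filter is orthogonal to one of its members, then the compact
open sets `{F | e ∈ F}` form a basis of the tight spectrum. -/
theorem TightSpectrum.exists_mem_subset_of_isOpen
    (hS : ∀ (F : TightSpectrum S) (f : S), IsIdempotentElem f → f ∉ F.1.1 →
      ∃ e ∈ F.1.1, e * f = 0)
    {V : Set (TightSpectrum S)} (hV : IsOpen V) {F : TightSpectrum S} (hF : F ∈ V) :
    ∃ e ∈ F.1.1, ∀ H : TightSpectrum S, e ∈ H.1.1 → H ∈ V := by
  classical
  obtain ⟨W, hW, rfl⟩ := isOpen_induced_iff.1 hV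
  have hW' : TopologicalSpace.GenerateOpen {U | ∃ (e : S) (Y : Finset S), IsIdempotentElem e ∧
      (∀ f ∈ Y, IsIdempotentElem f) ∧
      U = {F : ProperFilter S | e ∈ F.1 ∧ ∀ f ∈ Y, f ∉ F.1}} W := hW
  clear hW hV
  -- Only the generating sets use the orthogonality hypothesis: each excluded `f` is traded for a
  -- member `k'` with `k' * f = 0`, since a proper filter cannot contain both. The other cases
  -- combine witnesses by products.
  induction hW' with
  | basic U hU =>
    obtain ⟨e, Y, he, hY, rfl⟩ := hU
    obtain ⟨heF, hYF⟩ := hF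
    have key : ∀ Z : Finset S, Z ⊆ Y →
        ∃ k ∈ F.1.1, ∀ H : TightSpectrum S, k ∈ H.1.1 → ∀ f ∈ Z, f ∉ H.1.1 := by
      intro Z
      induction Z using Finset.induction_on with
      | empty => exact fun _ => ⟨e, heF, by simp⟩
      | insert f Z _ ih =>
        intro hZ
        obtain ⟨k, hkF, hk⟩ := ih ((Finset.subset_insert _ _).trans hZ)
        have hfY := hZ (Finset.mem_insert_self f Z)
        obtain ⟨k', hkF', hk'⟩ := hS F f (hY f hfY) (hYF f hfY)
        have hi := F.1.2.1.idem k hkF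
        have hi' := F.1.2.1.idem k' hkF'
        refine ⟨k * k', F.1.2.1.mul_mem _ hkF _ hkF', fun H hH f' hf' => ?_⟩
        obtain ⟨h1, h2⟩ := (H.mul_mem_iff hi hi').1 hH
        rcases Finset.mem_insert.1 hf' with rfl | hf'
        · intro h3
          have h4 := H.1.2.1.mul_mem _ h2 _ h3
          rw [hk'] at h4
          exact H.1.2.2 h4
        · exact hk H h1 f' hf'
    obtain ⟨k, hkF, hk⟩ := key Y subset_rfl
    refine ⟨e * k, F.1.2.1.mul_mem _ heF _ hkF, fun H hH => ?_⟩
    obtain ⟨h1, h2⟩ := (H.mul_mem_iff he (F.1.2.1.idem k hkF)).1 hH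
    exact ⟨h1, hk H h2⟩
  | univ =>
    obtain ⟨e, he⟩ := F.1.2.1.nonempty
    exact ⟨e, he, fun _ _ => trivial⟩
  | inter U W _ _ ih1 ih2 =>
    obtain ⟨e, he, h1⟩ := ih1 hF.1
    obtain ⟨f, hf, h2⟩ := ih2 hF.2
    refine ⟨e * f, F.1.2.1.mul_mem _ he _ hf, fun H hH => ?_⟩
    obtain ⟨h3, h4⟩ := (H.mul_mem_iff (F.1.2.1.idem e he) (F.1.2.1.idem f hf)).1 hH
    exact ⟨h1 H h3, h2 H h4⟩
  | sUnion 𝒰 _ ih =>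
    obtain ⟨U, hU, hFU⟩ := hF
    obtain ⟨e, he, h1⟩ := ih U hU hFU
    exact ⟨e, he, fun H hH => ⟨U, hU, h1 H hH⟩⟩

/-- Around `[s, F]` the set `V` is first shrunk to `{H | e ∈ H}`. Then `s * e` has the same germ at
`F`, and its domain idempotent is `e * (star s * s)`, so its full bracket already encodes the
restriction to `e`. -/
theorem isTopologicalBasis_compact_brackets
    (hS : ∀ (F : TightSpectrum S) (f : S), IsIdempotentElem f → f ∉ F.1.1 →
      ∃ e ∈ F.1.1, e * f = 0) :
    TopologicalSpace.IsTopologicalBasis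
      {U : Set (TightGerm S) | ∃ s : S, s ≠ 0 ∧ U = bracket s {F | star s * s ∈ F.1.1}} := by
  refine TopologicalSpace.isTopologicalBasis_of_isOpen_of_nhds ?_ ?_
  · rintro _ ⟨s, -, rfl⟩
    exact isOpen_bracket s (isOpen_mem (star_mul_self_idem s))
  · intro x U hx hU
    obtain ⟨_, ⟨s, V, hV, rfl⟩, hxV, hVU⟩ :=
      isTopologicalBasis_bracket.exists_subset_of_mem_open hx hU
    obtain ⟨F, hF, hs, rfl⟩ := hxV
    obtain ⟨e, he, heV⟩ := TightSpectrum.exists_mem_subset_of_isOpen hS hV hF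
    have hei := F.1.2.1.idem e he
    have hss := star_mul_self_idem s
    have hse : star (s * e) * (s * e) = e * (star s * s) := by
      rw [star_mul_rev, star_of_idem hei]
      calc e * star s * (s * e) = e * (star s * s * e) := by simp only [mul_assoc]
        _ = e * (star s * s) := by rw [idem_comm hss hei, ← mul_assoc, hei.eq]
    have hmem : ∀ H : TightSpectrum S, star (s * e) * (s * e) ∈ H.1.1 ↔
        e ∈ H.1.1 ∧ star s * s ∈ H.1.1 := fun H => by rw [hse, H.mul_mem_iff hei hss]
    have hsee : s * e * e = s * e := by rw [mul_assoc, hei.eq]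
    refine ⟨_, ⟨s * e, ?_, rfl⟩,
      mk_mem_bracket.2 ⟨(hmem F).2 ⟨he, hs⟩, (hmem F).2 ⟨he, hs⟩, e, he, hsee.symm⟩, ?_⟩
    -- If `s * e` were zero, its domain idempotent, a member of `F`, would be zero as well.
    · intro h
      have := (hmem F).2 ⟨he, hs⟩
      rw [h, mul_zero] at this
      exact F.1.2.2 this
    · rintro _ ⟨H, hH, hH', rfl⟩
      obtain ⟨h1, h2⟩ := (hmem H).1 hH
      exact hVU (mk_mem_bracket.2 ⟨heV H h1, h2, e, h1, hsee⟩)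

end

end TightGroupoid

namespace SelfSimilarUltragraph

variable {G V E : Type*} [Group G] [MulAction G V] [MulAction G E]
variable {X : SelfSimilarUltragraph G V E}

open InverseSemigroupWithZero

/-! ### Idempotents of the ultragraph semigroup as partial identities. -/

namespace InvSemigroup

/-- An idempotent partial bijection is a partial identity. Hence idempotents can be handled as
subsets, namely their domains: products become intersections, the order becomes inclusion, and
orthogonality becomes disjointness. -/
theorem rel_idem {e : X.InvSemigroup} (he : IsIdempotentElem e) {x y : List E × V × G}
    (h : rel e x y) : x = y := by
  have h1 := h
  rw [← he.eq, rel_mul] at h1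
  obtain ⟨z, hz, hzy⟩ := h1
  obtain rfl := rel_right_unique h hz
  exact rel_left_unique h hzy

theorem rel_idem_mul {e f : X.InvSemigroup} (hf : IsIdempotentElem f)
    (x : List E × V × G) : rel (e * f) x x ↔ rel e x x ∧ rel f x x := by
  rw [rel_mul]
  constructor
  · rintro ⟨y, h1, h2⟩
    obtain rfl := rel_idem hf h1
    exact ⟨h2, h1⟩
  · exact fun h => ⟨x, h.2, h.1⟩

theorem ext_of_rel_idem {e f : X.InvSemigroup} (he : IsIdempotentElem e)
    (hf : IsIdempotentElem f) (h : ∀ x, rel e x x ↔ rel f x x) : e = f := by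
  refine rel_injective ?_
  funext x y
  refine propext ⟨fun h1 => ?_, fun h1 => ?_⟩
  · obtain rfl := rel_idem he h1
    exact (h x).1 h1
  · obtain rfl := rel_idem hf h1
    exact (h x).2 h1

theorem isIdempotentElem_zero : IsIdempotentElem (0 : X.InvSemigroup) := zero_mul' 0

theorem mul_eq_zero_of_rel {e f : X.InvSemigroup} (he : IsIdempotentElem e)
    (hf : IsIdempotentElem f) (h : ∀ x, rel e x x → ¬ rel f x x) : e * f = 0 := by
  refine ext_of_rel_idem (idem_mul he hf) isIdempotentElem_zero fun x => ?_
  rw [rel_idem_mul hf]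
  exact iff_of_false (fun h1 => h x h1.1 h1.2) (not_rel_zero x x)

theorem not_rel_of_mul_eq_zero {e f : X.InvSemigroup} (hf : IsIdempotentElem f)
    (h : e * f = 0) {x : List E × V × G} (hx : rel e x x) :
    ¬ rel f x x := by
  intro hx'
  have h1 := (rel_idem_mul hf x).2 ⟨hx, hx'⟩
  rw [h] at h1
  exact not_rel_zero x x h1

theorem natLE_of_rel {e f : X.InvSemigroup} (he : IsIdempotentElem e) (hf : IsIdempotentElem f)
    (h : ∀ x, rel e x x → rel f x x) : NatLE e f := by
  refine ⟨e, he, ext_of_rel_idem he (idem_mul hf he) fun x => ?_⟩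
  rw [rel_idem_mul he]
  exact ⟨fun h1 => ⟨h x h1, h1⟩, fun h1 => h1.2⟩

end InvSemigroup

open InvSemigroup

section

variable {α : List E} {A : Set V} (hα : X.IsPath α) (hA : X.IsGen A) (hne : A.Nonempty)
  (hsub : A ⊆ X.source α)

/-- The domain of `(α, A)` consists of the points whose path begins with `α` and next meets a vertex
of `A`: the range of the remainder `ε`, or the vertex coordinate if `ε` is empty. -/
theorem rel_ultrapathIdem {x y : List E × V × G} :
    rel (X.ultrapathIdem α A hα hA hne hsub) x y ↔
      x = y ∧ ∃ ε, x.1 = α ++ ε ∧ X.start ε x.2.1 ∈ A := by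
  rw [ultrapathIdem, rel_elt]
  obtain ⟨l, v, g⟩ := x
  constructor
  · rintro ⟨ε, h1, h2, rfl⟩
    dsimp only at h1 h2
    rw [one_smul] at h2
    exact ⟨by simp [act_one, coc_one, h1], ε, h1, h2⟩
  · rintro ⟨rfl, ε, h1, h2⟩
    dsimp only at h1 h2
    exact ⟨ε, h1, by rwa [one_smul], by simp [act_one, coc_one, h1]⟩

theorem rel_ultrapathIdem_self {x : List E × V × G} :
    rel (X.ultrapathIdem α A hα hA hne hsub) x x ↔
      ∃ ε, x.1 = α ++ ε ∧ X.start ε x.2.1 ∈ A := by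
  simp [rel_ultrapathIdem]

theorem isIdempotentElem_ultrapathIdem :
    IsIdempotentElem (X.ultrapathIdem α A hα hA hne hsub) := by
  refine rel_injective ?_
  funext x y
  refine propext ?_
  rw [rel_mul]
  simp only [rel_ultrapathIdem]
  constructor
  · rintro ⟨z, ⟨rfl, h⟩, rfl, -⟩
    exact ⟨rfl, h⟩
  · rintro ⟨rfl, h⟩
    exact ⟨x, ⟨rfl, h⟩, rfl, h⟩

end

theorem exists_eq_ultrapathIdem {e : X.InvSemigroup} (he : IsIdempotentElem e) (h0 : e ≠ 0) :
    ∃ (α : List E) (A : Set V) (hα : X.IsPath α) (hA : X.IsGen A) (hne : A.Nonempty)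
      (hsub : A ⊆ X.source α), e = X.ultrapathIdem α A hα hA hne hsub := by
  obtain rfl | ⟨p, rfl⟩ := e.cases
  · exact absurd rfl h0
  obtain ⟨a, ha⟩ := p.A_nonempty
  -- The base point `(β, g⁻¹ a, 1)` goes to `(α, a, g)`. As it must be fixed, `α = β` and `g = 1`;
  -- the group coordinate detects `g` even where it acts trivially.
  have h1 := p.rel_base (v := p.g⁻¹ • a) (by simpa using ha)
  rw [← rel_elt] at h1
  have h2 := rel_idem he h1
  simp only [Prod.mk.injEq] at h2
  refine ⟨p.α, p.A, p.α_path, p.A_gen, p.A_nonempty, p.A_sub.trans Set.inter_subset_left, ?_⟩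
  exact congrArg Quad.elt (Quad.ext rfl rfl h2.2.2.symm h2.1)

/-! ### Every idempotent outside a tight filter is orthogonal to one of its members. -/

section

variable (F : TightSpectrum X.InvSemigroup)

/-- If a tight filter contains `(α, A)` but not `(α, B)`, then it contains `(α, A \ B)`, which is
orthogonal to `(α, B)`. -/
theorem exists_mem_mul_ultrapathIdem_eq_zero {α : List E} {A B : Set V} (hα : X.IsPath α)
    (hA : X.IsGen A) (hAne : A.Nonempty) (hAs : A ⊆ X.source α) (hB : X.IsGen B)
    (hBne : B.Nonempty) (hBs : B ⊆ X.source α)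
    (hF : X.ultrapathIdem α A hα hA hAne hAs ∈ F.1.1)
    (hBF : X.ultrapathIdem α B hα hB hBne hBs ∉ F.1.1) :
    ∃ e ∈ F.1.1, e * X.ultrapathIdem α B hα hB hBne hBs = 0 := by
  classical
  have hiA := isIdempotentElem_ultrapathIdem hα hA hAne hAs
  have hiB := isIdempotentElem_ultrapathIdem hα hB hBne hBs
  have hD : (A \ B).Nonempty := by
    rw [Set.nonempty_iff_ne_empty, Ne, Set.sdiff_eq_empty]
    intro hAB
    refine hBF (F.1.2.1.up _ hF _ hiB (natLE_of_rel hiA hiB fun x hx => ?_))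
    rw [rel_ultrapathIdem_self] at hx ⊢
    obtain ⟨ε, h1, h2⟩ := hx
    exact ⟨ε, h1, hAB h2⟩
  have hDs : A \ B ⊆ X.source α := Set.sdiff_subset.trans hAs
  have hiD := isIdempotentElem_ultrapathIdem hα (.diff hA hB) hD hDs
  refine ⟨X.ultrapathIdem α (A \ B) hα (.diff hA hB) hD hDs, ?_,
    mul_eq_zero_of_rel hiD hiB fun x hx hx' => ?_⟩
  · by_contra hDF
    -- If `F` missed both pieces, some nonzero `k` below `(α, A)` would be orthogonal to both. But a
    -- point in the domain of `k` continues after `α` from a vertex either in `B` or in `A \ B`.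
    obtain ⟨k, hk, hk0, hle, hkY⟩ := F.exists_orthogonal hF
      {X.ultrapathIdem α B hα hB hBne hBs, X.ultrapathIdem α (A \ B) hα (.diff hA hB) hD hDs}
      (by simp [hiB, hiD]) (by simp [hBF, hDF])
    obtain ⟨γ, C, hγ, hC, hCne, hCs, rfl⟩ := exists_eq_ultrapathIdem hk hk0
    obtain ⟨c, hc⟩ := hCne
    have hx : rel (X.ultrapathIdem γ C hγ hC ⟨c, hc⟩ hCs) (γ, c, 1) (γ, c, 1) :=
      (rel_ultrapathIdem_self ..).2 ⟨[], by simp, hc⟩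
    have hxA := hx
    rw [← hle, rel_idem_mul hk, rel_ultrapathIdem_self] at hxA
    obtain ⟨⟨ε, h1, h2⟩, -⟩ := hxA
    by_cases hb : X.start ε c ∈ B
    · exact not_rel_of_mul_eq_zero hiB (hkY _ (by simp)) hx
        ((rel_ultrapathIdem_self ..).2 ⟨ε, h1, hb⟩)
    · exact not_rel_of_mul_eq_zero hiD (hkY _ (by simp)) hx
        ((rel_ultrapathIdem_self ..).2 ⟨ε, h1, h2, hb⟩)
  · rw [rel_ultrapathIdem_self] at hx hx'
    obtain ⟨ε, h1, h2⟩ := hx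
    obtain ⟨ε', h1', h2'⟩ := hx'
    obtain rfl := List.append_cancel_left (h1.symm.trans h1')
    exact h2.2 h2'

theorem isPath_concat {α : List E} (hα : X.IsPath α) {e : E} (he : X.r e ∈ X.source α) :
    X.IsPath (α ++ [e]) :=
  (X.isPath_append (List.cons_ne_nil e [])).2
    ⟨hα, List.isChain_singleton e, Set.singleton_subset_iff.2 he⟩

theorem source_concat (α : List E) (e : E) : X.source (α ++ [e]) = X.s e :=
  X.source_append α [e] (List.cons_ne_nil e [])

/-- If `l` is empty this is the assumption on `v`; otherwise it is the path condition at the first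
junction. -/
theorem start_mem_s {e : E} {l : List E} (h : X.IsPath (e :: l)) {v : V}
    (hv : v ∈ X.source (e :: l)) : X.start l v ∈ X.s e := by
  cases l with
  | nil => exact hv
  | cons f l => exact (List.isChain_cons_cons.1 h).1

/-- A tight filter containing `(α, {v})` contains `(αe, s(e))` for some edge `e` with range `v`. -/
theorem exists_edge_mem (hrow : X.RowFinite) (hsrc : X.SourceFree) {α : List E} {v : V}
    (hα : X.IsPath α) (hv : {v} ⊆ X.source α)
    (hF : X.ultrapathIdem α {v} hα (.vertex v) (Set.singleton_nonempty v) hv ∈ F.1.1) :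
    ∃ (e : E) (he : X.r e ∈ X.source α), X.r e = v ∧
      X.ultrapathIdem (α ++ [e]) (X.s e) (isPath_concat hα he) (.source e) (X.s_nonempty e)
        (source_concat α e).superset ∈ F.1.1 := by
  classical
  have hva : v ∈ X.source α := hv rfl
  let ι := {e : E // X.r e = v}
  have : Fintype ι := (hrow v).fintype
  have hι : ∀ e : ι, X.r e.1 ∈ X.source α := fun e => e.2.symm ▸ hva
  let q : ι → X.InvSemigroup := fun e =>
    X.ultrapathIdem (α ++ [e.1]) (X.s e.1) (isPath_concat hα (hι e)) (.source e.1)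
      (X.s_nonempty e.1) (source_concat α e.1).superset
  have hq : ∀ e, IsIdempotentElem (q e) := fun e => isIdempotentElem_ultrapathIdem ..
  by_contra! hne
  have hi := isIdempotentElem_ultrapathIdem hα (.vertex v) (Set.singleton_nonempty v) hv
  -- Row-finiteness makes the family of all `(αe, s(e))` with `r(e) = v` finite, as tightness
  -- requires. It remains to see that no nonzero `k` below `(α, {v})` avoids it.
  obtain ⟨k, hk, hk0, hle, hkY⟩ := F.exists_orthogonal hF (Finset.univ.image q)
    (by simpa using hq) (by
      intro f hf
      obtain ⟨e, -, rfl⟩ := Finset.mem_image.1 hf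
      exact hne e.1 (hι e) e.2)
  have hkq : ∀ e x, rel k x x → ¬ rel (q e) x x := fun e x =>
    not_rel_of_mul_eq_zero (hq e)
      (hkY _ (Finset.mem_image_of_mem q (Finset.mem_univ e)))
  obtain ⟨γ, C, hγ, hC, ⟨c, hc⟩, hCs, rfl⟩ := exists_eq_ultrapathIdem hk hk0
  have hx : rel (X.ultrapathIdem γ C hγ hC ⟨c, hc⟩ hCs) (γ, c, 1) (γ, c, 1) :=
    (rel_ultrapathIdem_self ..).2 ⟨[], by simp, hc⟩
  have hxv := hx
  rw [← hle, rel_idem_mul hk, rel_ultrapathIdem_self] at hxv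
  obtain ⟨⟨η, h1, h2⟩, -⟩ := hxv
  obtain rfl : γ = α ++ η := h1
  -- If `k` sits at `α` itself, the vertex `v` lies in `C`, and an edge `e` into `v`, given by
  -- source-freeness, yields the point `(αe, w, 1)` common to `k` and `q e`. If its path extends
  -- `α`, the first further edge has range `v`, and the point of `k` at hand already lies in the
  -- domain of `q e`.
  cases η with
  | nil =>
    obtain rfl : c = v := h2
    obtain ⟨e, he⟩ := hsrc c
    obtain ⟨w, hw⟩ := X.s_nonempty e
    refine hkq ⟨e, he⟩ (α ++ [e], w, 1) ((rel_ultrapathIdem_self ..).2 ⟨[e], by simp, ?_⟩)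
      ((rel_ultrapathIdem_self ..).2 ⟨[], by simp, hw⟩)
    have he' : X.r e = c := he
    change X.r e ∈ C
    rwa [he']
  | cons e η =>
    refine hkq ⟨e, h2⟩ _ hx ((rel_ultrapathIdem_self ..).2 ⟨η, by simp, ?_⟩)
    have hp := ((X.isPath_append (List.cons_ne_nil e η)).1 hγ).2.1
    refine start_mem_s hp ?_
    have := hCs hc
    rwa [X.source_append α _ (List.cons_ne_nil e η)] at this

/-- Induction along the path `ε` from `α` to `β`, with `α` advancing one edge at a time. Let `e` be
the next edge. If `r(e) ∉ A`, then `(α, A)` is orthogonal to `(β, B)`; if `F` omits `(α, {r(e)})`,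
which lies above `(β, B)`, a member orthogonal to it works. Otherwise `F` contains some `(αf,
s(f))`: for `f ≠ e` the paths diverge, and for `f = e` the induction continues. At `α = β` the
relative complement decides. -/
theorem exists_mem_mul_eq_zero_of_extension (hrow : X.RowFinite) (hsrc : X.SourceFree)
    {B : Set V} (hB : X.IsGen B) (hBne : B.Nonempty) (ε : List E) :
    ∀ {α β : List E} {A : Set V} (hα : X.IsPath α) (hA : X.IsGen A) (hAne : A.Nonempty)
      (hAs : A ⊆ X.source α) (hβ : X.IsPath β) (hBs : B ⊆ X.source β), β = α ++ ε →
      X.ultrapathIdem α A hα hA hAne hAs ∈ F.1.1 →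
      X.ultrapathIdem β B hβ hB hBne hBs ∉ F.1.1 →
      ∃ e ∈ F.1.1, e * X.ultrapathIdem β B hβ hB hBne hBs = 0 := by
  induction ε with
  | nil =>
    intro α β A hα hA hAne hAs hβ hBs h hF hBF
    obtain rfl : β = α := by simpa using h
    exact exists_mem_mul_ultrapathIdem_eq_zero F hα hA hAne hAs hB hBne hBs hF hBF
  | cons e ε ih =>
    rintro α β A hα hA hAne hAs hβ hBs rfl hF hBF
    have hiA := isIdempotentElem_ultrapathIdem hα hA hAne hAs
    have hiB := isIdempotentElem_ultrapathIdem hβ hB hBne hBs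
    by_cases hv : X.r e ∈ A
    swap
    · refine ⟨_, hF, mul_eq_zero_of_rel hiA hiB fun x hx hx' => hv ?_⟩
      rw [rel_ultrapathIdem_self] at hx hx'
      obtain ⟨η, h1, h2⟩ := hx
      obtain ⟨η', h1', -⟩ := hx'
      rw [h1', List.append_assoc] at h1
      obtain rfl := List.append_cancel_left h1
      exact h2
    have hvs : {X.r e} ⊆ X.source α := Set.singleton_subset_iff.2 (hAs hv)
    have hiv := isIdempotentElem_ultrapathIdem hα (.vertex (X.r e)) (Set.singleton_nonempty _) hvs
    by_cases hvF : X.ultrapathIdem α {X.r e} hα (.vertex _) (Set.singleton_nonempty _) hvs ∈ F.1.1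
    swap
    · obtain ⟨k, hkF, hk⟩ := exists_mem_mul_ultrapathIdem_eq_zero F hα hA hAne hAs (.vertex _)
        (Set.singleton_nonempty _) hvs hF hvF
      have hki := F.1.2.1.idem k hkF
      refine ⟨k, hkF, mul_eq_zero_of_rel hki hiB fun x hx hx' =>
        not_rel_of_mul_eq_zero hiv hk hx ?_⟩
      rw [rel_ultrapathIdem_self] at hx' ⊢
      obtain ⟨η, h1, -⟩ := hx'
      exact ⟨e :: ε ++ η, by rw [h1, List.append_assoc], rfl⟩
    obtain ⟨f, hf, -, hfF⟩ := exists_edge_mem F hrow hsrc hα hvs hvF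
    by_cases hfe : f = e
    · subst hfe
      exact ih _ _ _ _ hβ hBs (by simp) hfF hBF
    · refine ⟨_, hfF, mul_eq_zero_of_rel (isIdempotentElem_ultrapathIdem ..) hiB
        fun x hx hx' => hfe ?_⟩
      rw [rel_ultrapathIdem_self] at hx hx'
      obtain ⟨η, h1, -⟩ := hx
      obtain ⟨η', h1', -⟩ := hx'
      rw [h1', List.append_assoc, List.append_assoc] at h1
      have := List.append_cancel_left h1
      simp only [List.cons_append, List.cons.injEq] at this
      exact this.1.symm

/-- An idempotent outside a tight filter is orthogonal to one of its members. -/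
theorem exists_mem_mul_eq_zero (hrow : X.RowFinite) (hsrc : X.SourceFree) (f : X.InvSemigroup)
    (hf : IsIdempotentElem f) (hfF : f ∉ F.1.1) : ∃ e ∈ F.1.1, e * f = 0 := by
  obtain ⟨e, he⟩ := F.1.2.1.nonempty
  have hei := F.1.2.1.idem e he
  by_cases h0 : f = 0
  · exact ⟨e, he, by rw [h0, mul_zero]⟩
  by_cases hef : e * f = 0
  · exact ⟨e, he, hef⟩
  -- Since the product is nonzero, the domains share a point, whose path begins with both `α` and
  -- `β`; so one of these is a prefix of the other.
  have hex : ∃ x, rel e x x ∧ rel f x x := by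
    by_contra! h
    exact hef (mul_eq_zero_of_rel hei hf h)
  obtain ⟨x, hxe, hxf⟩ := hex
  obtain ⟨α, A, hα, hA, hAne, hAs, rfl⟩ :=
    exists_eq_ultrapathIdem hei (fun h => F.1.2.2 (h ▸ he))
  obtain ⟨β, B, hβ, hB, hBne, hBs, rfl⟩ := exists_eq_ultrapathIdem hf h0
  rw [rel_ultrapathIdem_self] at hxe hxf
  obtain ⟨ε, h1, h2⟩ := hxe
  obtain ⟨ε', h1', h2'⟩ := hxf
  rw [h1] at h1'
  rcases List.append_eq_append_iff.1 h1' with ⟨η, h3, h4⟩ | ⟨η, h3, h4⟩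
  · exact exists_mem_mul_eq_zero_of_extension F hrow hsrc hB hBne η hα hA hAne hAs hβ hBs h3 he hfF
  · cases η with
    | nil =>
      exact exists_mem_mul_eq_zero_of_extension F hrow hsrc hB hBne [] hα hA hAne hAs hβ hBs
        (by simp [h3]) he hfF
    | cons d η =>
      -- When `α = βdη`, every point of `(α, A)` continues after `β` from `r(d)`. The common point
      -- shows `r(d) ∈ B`, so `(α, A) ≤ (β, B)` and upward closure gives a contradiction.
      refine absurd (F.1.2.1.up _ he _ hf (natLE_of_rel hei hf fun y hy => ?_)) hfF
      rw [rel_ultrapathIdem_self] at hy ⊢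
      obtain ⟨ζ, h5, -⟩ := hy
      refine ⟨d :: η ++ ζ, by rw [h5, h3, List.append_assoc], ?_⟩
      rw [h4] at h2'
      exact h2'

end

/-! ### The sets `Θ` as compact brackets, and the final assembly. -/

theorem star_mul_self_elt (p : X.Quad) :
    star p.elt * p.elt = X.ultrapathIdem p.β (p.g⁻¹ • p.A) p.β_path (X.isGen_smul _ p.A_gen)
      p.A_nonempty.smul_set
      (Set.subset_smul_set_iff.1 (p.A_sub.trans Set.inter_subset_right)) := by
  refine ext_of_rel_idem (star_mul_self_idem p.elt)
    (isIdempotentElem_ultrapathIdem ..) fun x => ?_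
  simp only [rel_mul, rel_star, rel_ultrapathIdem_self, and_self, rel_elt]
  constructor
  · rintro ⟨_, ε, h1, h2, -⟩
    exact ⟨ε, h1, Set.mem_inv_smul_set_iff.2 h2⟩
  · rintro ⟨ε, h1, h2⟩
    exact ⟨_, ε, h1, Set.mem_inv_smul_set_iff.1 h2, rfl⟩

/-- Makes the general results on brackets applicable: the cylinder in the definition of `Θ p`
imposes nothing beyond definedness of the germ. -/
theorem Θ_eq_bracket (p : X.Quad) :
    Θ p = TightGerm.bracket p.elt {F | star p.elt * p.elt ∈ F.1.1} := by
  rw [star_mul_self_elt]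
  rfl

theorem isTopologicalBasis_range_Θ (hrow : X.RowFinite) (hsrc : X.SourceFree) :
    TopologicalSpace.IsTopologicalBasis (Set.range fun p : X.Quad => Θ p) := by
  convert isTopologicalBasis_compact_brackets (S := X.InvSemigroup)
    fun F => exists_mem_mul_eq_zero F hrow hsrc using 1
  ext U
  constructor
  · rintro ⟨p, rfl⟩
    exact ⟨p.elt, p.elt_ne_zero, Θ_eq_bracket p⟩
  · rintro ⟨s, hs, rfl⟩
    obtain rfl | ⟨p, rfl⟩ := s.cases
    · exact absurd rfl hs
    · exact ⟨p, Θ_eq_bracket p⟩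

theorem isOpen_Θ (p : X.Quad) : IsOpen (Θ p) := by
  rw [Θ_eq_bracket]
  exact TightGerm.isOpen_bracket _ (TightSpectrum.isOpen_mem (star_mul_self_idem _))

theorem isCompact_Θ (p : X.Quad) : IsCompact (Θ p) := by
  rw [Θ_eq_bracket]
  exact TightGerm.isCompact_bracket _

theorem isBisection_Θ (p : X.Quad) : (tightGroupoid X.InvSemigroup).IsBisection (Θ p) := by
  rw [Θ_eq_bracket]
  exact isBisection_bracket _ (TightSpectrum.isOpen_mem (star_mul_self_idem _))

end SelfSimilarUltragraph

open SelfSimilarUltragraph in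
theorem locallyCompactSpace_tightGerm {G V E : Type*} [Group G] [MulAction G V] [MulAction G E]
    (X : SelfSimilarUltragraph G V E) (hrow : X.RowFinite) (hsrc : X.SourceFree) :
    LocallyCompactSpace (TightGerm X.InvSemigroup) := by
  refine ⟨fun x U hU => ?_⟩
  obtain ⟨_, ⟨p, rfl⟩, hx, hpU⟩ := (isTopologicalBasis_range_Θ hrow hsrc).mem_nhds_iff.1 hU
  -- A compact open basis gives compact neighbourhoods inside any neighbourhood, with no appeal to
  -- separation of the germ space.
  exact ⟨_, (isOpen_Θ p).mem_nhds hx, hpU, isCompact_Θ p⟩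

theorem proposition6p4 {G V E : Type*} [Group G] [MulAction G V] [MulAction G E]
    (X : SelfSimilarUltragraph G V E) (hrow : X.RowFinite) (hsrc : X.SourceFree) :
    (tightGroupoid X.InvSemigroup).IsAmple ∧
    T2Space (tightGroupoid X.InvSemigroup).units ∧
    (∀ p : X.Quad, IsCompact (SelfSimilarUltragraph.Θ p) ∧
      IsOpen (SelfSimilarUltragraph.Θ p) ∧
      (tightGroupoid X.InvSemigroup).IsBisection (SelfSimilarUltragraph.Θ p)) ∧
    TopologicalSpace.IsTopologicalBasis
      (Set.range fun p : X.Quad => SelfSimilarUltragraph.Θ p) := by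
  have hΘ : ∀ p : X.Quad, IsCompact (SelfSimilarUltragraph.Θ p) ∧
      IsOpen (SelfSimilarUltragraph.Θ p) ∧
      (tightGroupoid X.InvSemigroup).IsBisection (SelfSimilarUltragraph.Θ p) := fun p =>
    ⟨SelfSimilarUltragraph.isCompact_Θ p, SelfSimilarUltragraph.isOpen_Θ p,
      SelfSimilarUltragraph.isBisection_Θ p⟩
  have hbasis := SelfSimilarUltragraph.isTopologicalBasis_range_Θ hrow hsrc
  refine ⟨⟨⟨tightGroupoid_isTopological, locallyCompactSpace_tightGerm X hrow hsrc,
    isLocalHomeomorph_tightGroupoid_rangeMap, isLocalHomeomorph_tightGroupoid_sourceMap⟩,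
    _, hbasis, ?_⟩, t2Space_tightGroupoid_units, hΘ, hbasis⟩
  rintro _ ⟨p, rfl⟩
  exact hΘ p
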